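/- Let $K$ be an algebraically closed field of characteristic zero and let $\mathfrak g$ be a finite-dimensional reductive Lie algebra over $K$, i.e. the solvable radical of $\mathfrak g$ equals its center $\mathfrak g_Z$. Let $\mathfrak g_S$ be the maximal semisimple ideal of $\mathfrak g$, so that $\mathfrak g=\mathfrak g_Z\oplus\mathfrak g_S$. Let $\mathfrak q=\mathfrak g_Z\oplus\mathfrak q_S$ be a parabolic subalgebra of $\mathfrak g$; that is, $\mathfrak q$ is a subalgebra containing $\mathfrak g_Z$, and $\mathfrak q_S=\mathfrak q\cap\mathfrak g_S$ contains a Borel subalgebra $\mathfrak h\dotplus\sum_{\alpha\in\Phi^+}(\mathfrak g_S)_\alpha$ of $\mathfrak g_S$ (for some Cartan subalgebra $\mathfrak h$ of $\mathfrak g_S$ and some positive system $\Phi^+$ of its roots). Write $\mathfrak q_Z$ for the center of $\mathfrak q$, and write $\dotplus$ for a direct sum of vector spaces and $\oplus$ for a direct sum of Lie algebras (or ideals). (1) Let $\mathfrak L$ be the set of all $K$-linear maps $\mathfrak q\to\mathfrak q$ that map $\mathfrak q$ into $\mathfrak q_Z$ and map $[\mathfrak q,\mathfrak q]$ to $0$.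 Then $\mathfrak L$ consists of derivations, $\mathfrak L$ and $\operatorname{ad}\mathfrak q$ are ideals of $\operatorname{Der}\mathfrak q$, and $$\operatorname{Der}\mathfrak q=\mathfrak L\oplus\operatorname{ad}\mathfrak q .$$ (2) Let $\mathfrak h$ be any Cartan subalgebra of $\mathfrak g_S$ with root system $\Phi$, let $\Delta$ be a base of $\Phi$ with positive roots $\Phi^+$, and let $\Delta'\subseteq\Delta$ be such that $\mathfrak q_S=\mathfrak h\dotplus\sum_{\alpha\in\Phi'}(\mathfrak g_S)_\alpha$, where $\Phi'=\Phi^+\cup(\Phi\cap\operatorname{span}\Delta')$. Let $\mathfrak c\subseteq\mathfrak h$ be the span of the coroots of the simple roots in $\Delta\setminus\Delta'$. Then: (a) $\mathfrak q=\mathfrak g_Z\dotplus\mathfrak c\dotplus[\mathfrak q,\mathfrak q]$; (b) $\mathfrak L$ is the set of all $K$-linear maps $\mathfrak q\to\mathfrak q$ that map $\mathfrak g_Z+\mathfrak c$ into $\mathfrak g_Z$ and map $[\mathfrak q,\mathfrak q]$ to $0$; (c) as Lie algebras, $$\operatorname{Der}\mathfrak q\;\cong\;\operatorname{Hom}_K(\mathfrak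 g_Z\dotplus\mathfrak c,\ \mathfrak g_Z)\oplus\mathfrak q_S ,$$ where $\operatorname{Hom}_K(V_1\dotplus V_2,V_1)$ denotes the Lie algebra given by the semidirect sum $\mathfrak{gl}(V_1)\ltimes\operatorname{Hom}_K(V_2,V_1)$, in which $\operatorname{Hom}_K(V_2,V_1)$ is an abelian ideal and $f\in\mathfrak{gl}(V_1)$ acts on $g\in\operatorname{Hom}_K(V_2,V_1)$ by $f\cdot g=f\circ g$. -/

import Mathlib

open LieAlgebra LieAlgebra.IsKilling

namespace LieParabolic

section SemisimplePart

variable (K : Type*) (g : Type*) [Field K] [LieRing g] [LieAlgebra K g]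

/-- The maximal semisimple ideal of a Lie algebra: the sum of all its semisimple ideals.
By `isGreatest_semisimplePart` it is the greatest semisimple ideal. -/
def semisimplePart : LieIdeal K g := sSup {I : LieIdeal K g | IsSemisimple K I}

variable {K g}

lemma centralizer_inf_eq_zero {I : LieIdeal K g} [HasTrivialRadical K I] {x : g} (hx : x ∈ I)
    (h : ∀ y ∈ I, ⁅x, y⁆ = 0) : x = 0 := by
  have : (⟨x, hx⟩ : I) ∈ LieAlgebra.center K I := by
    rw [LieModule.mem_maxTrivSubmodule]
    intro y
    ext
    have := h y y.2
    rw [← lie_skew, neg_eq_zero] at this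
    exact this
  rw [LieAlgebra.center_eq_bot, LieSubmodule.mem_bot] at this
  simpa using this

lemma eq_zero_of_mem_abelian {S : LieIdeal K g} (A : LieIdeal K S) [IsLieAbelian A]
    (I : LieIdeal K g) [HasTrivialRadical K I] (hI : I ≤ S) {a : S} (ha : a ∈ A) {x : g}
    (hx : x ∈ I) : ⁅(a : g), x⁆ = 0 := by
  let B : LieIdeal K I := A.comap (LieIdeal.inclusion hI)
  have hB : IsLieAbelian B := by
    refine ⟨fun u v ↦ ?_⟩
    have hu : LieIdeal.inclusion hI u ∈ A := LieIdeal.mem_comap.1 u.2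
    have hv : LieIdeal.inclusion hI v ∈ A := LieIdeal.mem_comap.1 v.2
    have h := trivial_lie_zero A A ⟨_, hu⟩ ⟨_, hv⟩
    have h' := congrArg (fun z : A ↦ ((z : S) : g)) h
    ext
    simpa using h'
  have hbot := (hasTrivialRadical_iff_no_abelian_ideals K I).1 inferInstance B hB
  have hmem : (⟨⁅(a : g), x⁆, lie_mem_right K g I _ _ hx⟩ : I) ∈ B := by
    rw [LieIdeal.mem_comap]
    have : LieIdeal.inclusion hI ⟨⁅(a : g), x⁆, lie_mem_right K g I _ _ hx⟩
        = ⁅a, (⟨x, hI hx⟩ : S)⁆ := by ext; rfl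
    rw [this]
    exact lie_mem_left K S A _ _ ha
  rw [hbot, LieSubmodule.mem_bot] at hmem
  simpa using hmem

variable [CharZero K] [FiniteDimensional K g]

lemma isSemisimple_iff_hasTrivialRadical (I : LieIdeal K g) :
    IsSemisimple K I ↔ HasTrivialRadical K I :=
  ⟨fun _ ↦ inferInstance, fun _ ↦ inferInstance⟩

lemma hasTrivialRadical_sup (I J : LieIdeal K g) [HasTrivialRadical K I] [HasTrivialRadical K J] :
    HasTrivialRadical K (I ⊔ J : LieIdeal K g) := by
  rw [hasTrivialRadical_iff_no_abelian_ideals]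
  intro A hA
  rw [LieSubmodule.eq_bot_iff]
  intro a ha
  have hI : ∀ x ∈ I, ⁅(a : g), x⁆ = 0 := fun x hx ↦ eq_zero_of_mem_abelian A I le_sup_left ha hx
  have hJ : ∀ x ∈ J, ⁅(a : g), x⁆ = 0 := fun x hx ↦ eq_zero_of_mem_abelian A J le_sup_right ha hx
  obtain ⟨i, hi, j, hj, hij⟩ := (LieSubmodule.mem_sup _ _ _).1 a.2
  have hjI : ∀ y ∈ J, ⁅j, y⁆ ∈ I := by
    intro y hy
    have h := hJ y hy
    rw [← hij, add_lie] at h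
    rw [eq_neg_of_add_eq_zero_right h]
    exact neg_mem (lie_mem_left K g I _ _ hi)
  let M : LieIdeal K J := I.comap J.incl
  have hc := M.isCompl_killingCompl
  have htop : (⟨j, hj⟩ : J) ∈ M ⊔ M.killingCompl := by rw [hc.sup_eq_top]; trivial
  obtain ⟨m, hm, m', hm', hmm⟩ := (LieSubmodule.mem_sup _ _ _).1 htop
  have hmI : (m : g) ∈ I := by simpa [M] using hm
  have hdis : ∀ z : J, z ∈ M → z ∈ M.killingCompl → z = 0 := by
    intro z h1 h2
    have : z ∈ M ⊓ M.killingCompl := ⟨h1, h2⟩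
    rwa [hc.inf_eq_bot, LieSubmodule.mem_bot] at this
  have hm0 : m' = 0 := by
    have : (m' : g) = 0 := by
      refine centralizer_inf_eq_zero m'.2 fun y hy ↦ ?_
      have h0 : ⁅m', (⟨y, hy⟩ : J)⁆ = 0 := by
        refine hdis _ ?_ (lie_mem_left K J M.killingCompl _ _ hm')
        have h1 : ⁅m', (⟨y, hy⟩ : J)⁆ = ⁅(⟨j, hj⟩ : J), (⟨y, hy⟩ : J)⁆ - ⁅m, (⟨y, hy⟩ : J)⁆ := by
          rw [← hmm, add_lie]; abel
        rw [h1]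
        refine sub_mem ?_ (lie_mem_left K J M _ _ hm)
        simpa [M] using hjI y hy
      simpa using congrArg Subtype.val h0
    simpa using this
  have hjI' : j ∈ I := by
    have : (⟨j, hj⟩ : J) = m := by rw [← hmm, hm0, add_zero]
    have : j = m := congrArg Subtype.val this
    rwa [this]
  have haI : (a : g) ∈ I := by rw [← hij]; exact add_mem hi hjI'
  have := centralizer_inf_eq_zero haI hI
  simpa using this

variable (K g)

lemma isGreatest_semisimplePart :
    IsGreatest {I : LieIdeal K g | IsSemisimple K I} (semisimplePart K g) := by
  refine ⟨?_, fun I hI ↦ le_sSup hI⟩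
  refine (CompleteLattice.WellFoundedGT.isSupClosedCompact (LieIdeal K g) inferInstance)
    {I : LieIdeal K g | IsSemisimple K I} ⟨⊥, ?_⟩ ?_
  · exact (isSemisimple_iff_hasTrivialRadical _).2 inferInstance
  · intro I hI J hJ
    have h1 := (isSemisimple_iff_hasTrivialRadical I).1 hI
    have h2 := (isSemisimple_iff_hasTrivialRadical J).1 hJ
    exact (isSemisimple_iff_hasTrivialRadical _).2 (hasTrivialRadical_sup I J)

instance instHasTrivialRadicalSemisimplePart : HasTrivialRadical K (semisimplePart K g) :=
  (isSemisimple_iff_hasTrivialRadical _).1 (isGreatest_semisimplePart K g).1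

end SemisimplePart

section Standard

variable {K : Type*} {L : Type*} [Field K] [IsAlgClosed K] [CharZero K] [LieRing L] [LieAlgebra K L]
  [FiniteDimensional K L] [HasTrivialRadical K L]

/-- `Φ' = Φ⁺ ∪ (Φ ∩ span Δ')`, where `Φ` is the root system of the semisimple Lie algebra `L`
relative to the Cartan subalgebra `H`, `Φ⁺` is the set of roots that are positive relative to the
base `b`, and `Δ'` is a set of roots. -/
def standardRoots {H : LieSubalgebra K L} [H.IsCartanSubalgebra] (b : (rootSystem H).Base)
    (Δ' : Set H.root) : Set H.root :=
  {α | b.IsPos α ∨ (rootSystem H).root α ∈ Submodule.span K ((rootSystem H).root '' Δ')}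

/-- The subspace `H + ∑_{α ∈ Φ'} L_α` for the set of roots `Φ'` given by `b` and `Δ'`. -/
def standardParabolic {H : LieSubalgebra K L} [H.IsCartanSubalgebra] (b : (rootSystem H).Base)
    (Δ' : Set H.root) : Submodule K L :=
  H.toSubmodule ⊔ ⨆ α ∈ standardRoots b Δ', (rootSpace H (α : LieModule.Weight K H L)).toSubmodule

/-- A Borel subalgebra of a semisimple Lie algebra: a subalgebra `H + ∑_{α ∈ Φ⁺} L_α` for some
Cartan subalgebra `H` and some choice `Φ⁺` of positive roots. -/
def IsBorel (B : LieSubalgebra K L) : Prop :=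
  ∃ (H : LieSubalgebra K L) (_ : H.IsCartanSubalgebra) (b : (rootSystem H).Base),
    B.toSubmodule = H.toSubmodule ⊔
      ⨆ (α : H.root) (_ : b.IsPos α), (rootSpace H (α : LieModule.Weight K H L)).toSubmodule

end Standard

section Parabolic

variable {K : Type*} {g : Type*} [Field K] [LieRing g] [LieAlgebra K g]

/-- `q_S = q ∩ g_S`, as a subalgebra of the maximal semisimple ideal `g_S`. -/
def semisimpleInter (q : LieSubalgebra K g) : LieSubalgebra K (semisimplePart K g) :=
  q.comap (semisimplePart K g).incl

/-- A parabolic subalgebra `q` of a reductive Lie algebra `g`: it contains the center of `g`, and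
`q ∩ g_S` is a parabolic subalgebra of the semisimple Lie algebra `g_S`, that is, it contains a
Borel subalgebra of `g_S`. -/
structure IsParabolic [IsAlgClosed K] [CharZero K] [FiniteDimensional K g]
    (q : LieSubalgebra K g) : Prop where
  center_le : ∀ z ∈ center K g, z ∈ q
  exists_borel_le : ∃ B : LieSubalgebra K (semisimplePart K g), IsBorel B ∧ B ≤ semisimpleInter q

/-- `𝔠`: the subspace of `g` spanned by the coroots of the simple roots outside `Δ'`. (For a root
`α` the coroot is a nonzero multiple of `[x_α, x_{-α}]` for all nonzero root vectors
`x_α`, `x_{-α}`.) -/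
def corootSpan [IsAlgClosed K] [CharZero K] [FiniteDimensional K g]
    {H : LieSubalgebra K (semisimplePart K g)} [H.IsCartanSubalgebra] (b : (rootSystem H).Base)
    (Δ' : Set H.root) : Submodule K g :=
  Submodule.span K
    {x : g | ∃ α ∈ (b.support : Set H.root) \ Δ',
      x = (((rootSystem H).coroot α : H) : semisimplePart K g)}

/-- The derived algebra `[q, q]` of a subalgebra `q`, as a subspace of the ambient algebra. -/
def derivedSubspace (q : LieSubalgebra K g) : Submodule K g :=
  (⁅(⊤ : LieIdeal K q), (⊤ : LieIdeal K q)⁆).toSubmodule.map q.toSubmodule.subtype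

/-- `𝔏`: the linear endomorphisms of a Lie algebra that map into the center and vanish on the
derived algebra. -/
def centralMaps (K L : Type*) [Field K] [LieRing L] [LieAlgebra K L] : Set (L →ₗ[K] L) :=
  {f | (∀ x, f x ∈ center K L) ∧ ∀ x ∈ ⁅(⊤ : LieIdeal K L), (⊤ : LieIdeal K L)⁆, f x = 0}

end Parabolic

section Hom

variable (K : Type*) (V₁ V₂ : Type*) [Field K] [AddCommGroup V₁] [Module K V₁] [AddCommGroup V₂]
  [Module K V₂]

/-- `Hom(V₂, V₁)`, to be regarded as an abelian Lie algebra. -/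
def AbelianHom : Type _ := V₂ →ₗ[K] V₁

instance : AddCommGroup (AbelianHom K V₁ V₂) := inferInstanceAs (AddCommGroup (V₂ →ₗ[K] V₁))

instance : Module K (AbelianHom K V₁ V₂) := inferInstanceAs (Module K (V₂ →ₗ[K] V₁))

instance : LieRing (AbelianHom K V₁ V₂) where
  bracket _ _ := 0
  add_lie _ _ _ := (add_zero 0).symm
  lie_add _ _ _ := (add_zero 0).symm
  lie_self _ := rfl
  leibniz_lie _ _ _ := (add_zero 0).symm

instance : LieAlgebra K (AbelianHom K V₁ V₂) where
  lie_smul _ _ _ := (smul_zero _).symm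

attribute [local instance 100] LieRing.ofAssociativeRing

/-- The action of `gl(V₁)` on the abelian Lie algebra `Hom(V₂, V₁)` by `f · g = f ∘ g`. -/
def homAction : Module.End K V₁ →ₗ⁅K⁆ LieDerivation K (AbelianHom K V₁ V₂) (AbelianHom K V₁ V₂) where
  toFun f :=
    { toFun := fun g ↦ (LinearMap.comp f g : V₂ →ₗ[K] V₁)
      map_add' := fun g h ↦ LinearMap.comp_add g h f
      map_smul' := fun c g ↦ LinearMap.comp_smul f c g
      leibniz' := fun _ _ ↦ (LinearMap.comp_zero f).trans (sub_zero 0).symm }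
  map_add' _ _ := rfl
  map_smul' _ _ := rfl
  map_lie' := rfl

/-- The space `Hom(V₁ ∔ V₂, V₁)` as a Lie algebra: the semidirect sum of `gl(V₁)` and the abelian
ideal `Hom(V₂, V₁)`, on which `gl(V₁)` acts by composition. -/
abbrev HomLie : Type _ := SemiDirectSum (AbelianHom K V₁ V₂) (Module.End K V₁) (homAction K V₁ V₂)

end Hom

end LieParabolic

open LieParabolic

/-!
The argument has three parts.

*The center splits off.* Let `g` be reductive. Then `g / Z(g)` is semisimple, hence perfect, and
`g = Z(g) + [g, g]`. The sum is direct (`center_inf_derived`): a linear functional `l` on `g` gives a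
form `l [x, y]` that descends to `g / Z(g)`, where it is `κ(D x, y)` for a derivation `D`. Since `D` is
inner, `l` agrees on `[g, g]` with a functional that vanishes on the center. So `[g, g]` is a semisimple
ideal, and `g` is the direct sum of its center and its maximal semisimple ideal
(`isCompl_center_semisimplePart`).

*Derivations of a parabolic subalgebra.* A derivation of a subalgebra `p` of a semisimple Lie algebra
that contains a Borel subalgebra is inner (`ContainsBorel.exists_eq_ad`). After subtracting an inner
derivation it preserves the Cartan subalgebra `H`, because the bracket with a regular element is
invertible on the root spaces. It then kills `H`, as `ad h` is semisimple for `h` in `H`, and it acts on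
the simple root spaces by scalars. These are the values of the simple roots at an element of `H`, and a
derivation that kills `H` and the simple root vectors is zero. For a parabolic subalgebra `q` of a
reductive Lie algebra, projection to the semisimple part reduces to this case
(`IsParabolic.exists_sub_ad_mem`): every derivation is the sum of `ad u`, with `u` in the semisimple part
of `q`, and a derivation with values in the center of `q`, which is the center of `g`. A derivation with
central values vanishes on `[q, q]`, and conversely each linear map that does so and has central values
is a derivation.

*The complement of the derived algebra.* The coroots of `Δ'` and all root vectors of `q` lie in `[q, q]`,
so that `q` is the sum of the center, `𝔠` and `[q, q]`. The sum is direct because the Killing form pairs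
the fundamental coweight of a simple root outside `Δ'` to zero with `[q, q]`
(`killingForm_eq_zero_of_mem_bracketSpan`) and separates the simple coroots. With this decomposition,
the derivations with central values form the semidirect sum `Hom(V₁ ∔ V₂, V₁)`, and they commute with
the inner derivations (`DerivedSplitting.nonempty_equiv`).
-/

namespace LieParabolic

/-! ### Splitting off the center of a reductive Lie algebra -/

section Reductive

variable {K : Type*} {g : Type*} [Field K] [CharZero K] [LieRing g] [LieAlgebra K g]
  [FiniteDimensional K g]

/-- The Killing complement of the derived algebra is central, by invariance of the Killing form, hence
zero. -/
lemma derived_eq_top_of_hasTrivialRadical [HasTrivialRadical K g] :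
    ⁅(⊤ : LieIdeal K g), (⊤ : LieIdeal K g)⁆ = ⊤ := by
  have hc := LieIdeal.isCompl_killingCompl (⁅(⊤ : LieIdeal K g), (⊤ : LieIdeal K g)⁆)
  have hbot : LieIdeal.killingCompl K g ⁅(⊤ : LieIdeal K g), (⊤ : LieIdeal K g)⁆ = ⊥ := by
    rw [LieSubmodule.eq_bot_iff]
    intro x hx
    rw [LieIdeal.mem_killingCompl] at hx
    have hx0 : x ∈ center K g := by
      rw [LieModule.mem_maxTrivSubmodule]
      intro y
      have : ⁅y, x⁆ ∈ LinearMap.ker (killingForm K g) := by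
        rw [LinearMap.mem_ker]
        ext z
        have h := hx ⁅z, y⁆ (LieSubmodule.lie_mem_lie (by trivial) (by trivial))
        rw [LieModule.traceForm_apply_lie_apply] at h
        rw [LieModule.traceForm_comm]
        simpa using h
      simpa using this
    simpa using hx0
  have := hc.sup_eq_top
  rwa [hbot, sup_bot_eq] at this

omit [FiniteDimensional K g] in
lemma center_sup_derived_eq_top {Q : Type*} [LieRing Q] [LieAlgebra K Q] [FiniteDimensional K Q]
    [HasTrivialRadical K Q] {π : g →ₗ⁅K⁆ Q} (hπ : Function.Surjective π)
    (hker : ∀ x, π x = 0 ↔ x ∈ center K g) :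
    center K g ⊔ ⁅(⊤ : LieIdeal K g), (⊤ : LieIdeal K g)⁆ = ⊤ := by
  rw [eq_top_iff]
  have key : ∀ y ∈ ⁅(⊤ : LieIdeal K Q), (⊤ : LieIdeal K Q)⁆,
      ∃ w ∈ ⁅(⊤ : LieIdeal K g), (⊤ : LieIdeal K g)⁆, π w = y := by
    intro y hy
    rw [← LieSubmodule.mem_toSubmodule, LieSubmodule.lieIdeal_oper_eq_linear_span'] at hy
    induction hy using Submodule.span_induction with
    | mem y hy =>
      obtain ⟨a, -, b, -, rfl⟩ := hy
      obtain ⟨a, rfl⟩ := hπ a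
      obtain ⟨b, rfl⟩ := hπ b
      exact ⟨⁅a, b⁆, LieSubmodule.lie_mem_lie (by trivial) (by trivial), π.map_lie a b⟩
    | zero => exact ⟨0, zero_mem _, map_zero _⟩
    | add y z _ _ hy hz =>
      obtain ⟨a, ha, rfl⟩ := hy
      obtain ⟨b, hb, rfl⟩ := hz
      exact ⟨a + b, add_mem ha hb, map_add _ _ _⟩
    | smul c y _ hy =>
      obtain ⟨a, ha, rfl⟩ := hy
      exact ⟨c • a, (⁅(⊤ : LieIdeal K g), (⊤ : LieIdeal K g)⁆).smul_mem c ha, map_smul _ _ _⟩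
  intro x _
  obtain ⟨w, hw, hwx⟩ := key (π x) (by rw [derived_eq_top_of_hasTrivialRadical]; trivial)
  rw [LieSubmodule.mem_sup]
  refine ⟨x - w, (hker _).1 ?_, w, hw, sub_add_cancel _ _⟩
  rw [map_sub, hwx, sub_self]

/-- The center and the derived algebra of `g` are disjoint if `Q = g / Z(g)` is semisimple. For a
linear functional `l` on `g`, the form `(x, y) ↦ l ⁅x, y⁆` vanishes on the center, so it is
`κ(D x, y)` for an endomorphism `D` of `Q`. The Jacobi identity makes `D` a
derivation, hence `D = ad u`, and `l` agrees on the derived algebra with `κ(u, π ·)`, which vanishes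
on the center. -/
lemma center_inf_derived {Q : Type*} [LieRing Q] [LieAlgebra K Q] [FiniteDimensional K Q]
    [HasTrivialRadical K Q] {π : g →ₗ⁅K⁆ Q} (hπ : Function.Surjective π)
    (hker : ∀ x, π x = 0 ↔ x ∈ center K g) {z : g} (hz : z ∈ center K g)
    (hz' : z ∈ ⁅(⊤ : LieIdeal K g), (⊤ : LieIdeal K g)⁆) : z = 0 := by
  refine (Module.forall_dual_apply_eq_zero_iff K z).1 fun l ↦ ?_
  obtain ⟨σ, hσ⟩ := (π : g →ₗ[K] Q).exists_rightInverse_of_surjective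
    (LinearMap.range_eq_top.2 hπ)
  replace hσ : ∀ x, π (σ x) = x := fun x ↦ LinearMap.congr_fun hσ x
  have hl : ∀ x y : g, l ⁅σ (π x), σ (π y)⁆ = l ⁅x, y⁆ := by
    have h0 : ∀ x y : g, ⁅σ (π x) - x, y⁆ = 0 := by
      intro x y
      have : σ (π x) - x ∈ center K g := (hker _).1 (by rw [map_sub, hσ, sub_self])
      rw [LieModule.mem_maxTrivSubmodule] at this
      rw [← lie_skew, this, neg_zero]
    have h1 : ∀ x y : g, ⁅σ (π x), y⁆ = ⁅x, y⁆ := fun x y ↦ by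
      rw [← sub_eq_zero, ← sub_lie, h0]
    intro x y
    rw [h1, ← lie_skew, h1, lie_skew]
  let ω : Q →ₗ[K] Module.Dual K Q := LinearMap.mk₂ K (fun x y ↦ l ⁅σ x, σ y⁆)
    (by intros; simp) (by intros; simp) (by intros; simp) (by intros; simp)
  let e := (killingForm K Q).toDual (killingForm_nondegenerate K Q)
  let d : Q →ₗ[K] Q := e.symm.toLinearMap ∘ₗ ω
  have hd : ∀ x y : g, killingForm K Q (d (π x)) (π y) = l ⁅x, y⁆ := by
    intro x y
    have : killingForm K Q (d (π x)) = ω (π x) := e.apply_symm_apply _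
    rw [this]
    exact hl x y
  have hder : ∀ a b : Q, d ⁅a, b⁆ = ⁅a, d b⁆ - ⁅b, d a⁆ := by
    intro a b
    obtain ⟨x, rfl⟩ := hπ a
    obtain ⟨y, rfl⟩ := hπ b
    apply e.injective
    ext c
    obtain ⟨w, rfl⟩ := hπ c
    change killingForm K Q _ (π w) = killingForm K Q _ (π w)
    rw [← LieHom.map_lie, hd, map_sub, LinearMap.sub_apply,
      LieModule.traceForm_apply_lie_apply', LieModule.traceForm_apply_lie_apply',
      ← LieHom.map_lie, ← LieHom.map_lie, hd, hd, lie_lie x y w, map_sub,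
      ← lie_skew y ⁅x, w⁆, ← lie_skew x ⁅y, w⁆]
    simp only [map_neg]
    ring
  let D : LieDerivation K Q Q := ⟨d, hder⟩
  -- Derivations of a semisimple Lie algebra are inner.
  obtain ⟨u, hu⟩ := LieDerivation.IsKilling.exists_eq_ad D
  have hdu : ∀ a, d a = ⁅u, a⁆ := by
    intro a
    have := congrArg (fun E : LieDerivation K Q Q ↦ E a) hu
    exact (by simpa using this.symm : D a = ⁅u, a⁆)
  have key : ∀ w ∈ ⁅(⊤ : LieIdeal K g), (⊤ : LieIdeal K g)⁆, l w = killingForm K Q u (π w) := by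
    intro w hw
    rw [← LieSubmodule.mem_toSubmodule, LieSubmodule.lieIdeal_oper_eq_linear_span'] at hw
    induction hw using Submodule.span_induction with
    | mem y hy =>
      obtain ⟨a, -, b, -, rfl⟩ := hy
      rw [← hd, hdu, LieModule.traceForm_apply_lie_apply, LieHom.map_lie]
    | zero => simp
    | add y z _ _ hy hz => simp [hy, hz]
    | smul c y _ hy => simp [hy]
  rw [key z hz', (hker z).2 hz, map_zero]

variable (K g) in
omit [CharZero K] [FiniteDimensional K g] in
lemma exists_semisimple_quotient : ∃ π : g →ₗ⁅K⁆ g ⧸ center K g, Function.Surjective π ∧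
    ∀ x, π x = 0 ↔ x ∈ center K g :=
  ⟨{ (LieSubmodule.Quotient.mk' (center K g) : g →ₗ[K] g ⧸ center K g) with
      map_lie' := rfl },
    LieSubmodule.Quotient.surjective_mk' _, fun _ ↦ LieSubmodule.Quotient.mk_eq_zero _⟩

variable [HasCentralRadical K g]

/-- The preimage `B` in `g` of an abelian ideal of `g / Z(g)` satisfies `⁅B, B⁆ ≤ Z(g)`, so it is
solvable and lies in the radical, which is the center. -/
instance hasTrivialRadical_quotient_center : HasTrivialRadical K (g ⧸ center K g) := by
  obtain ⟨π, hπ, hker⟩ := exists_semisimple_quotient K g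
  rw [hasTrivialRadical_iff_no_abelian_ideals]
  intro A hA
  let B : LieIdeal K g := A.comap π
  have hBB : ⁅B, B⁆ ≤ center K g := by
    rw [LieSubmodule.lieIdeal_oper_eq_span, LieSubmodule.lieSpan_le]
    rintro _ ⟨x, y, rfl⟩
    have h := trivial_lie_zero A A ⟨π x, LieIdeal.mem_comap.1 x.2⟩ ⟨π y, LieIdeal.mem_comap.1 y.2⟩
    refine (hker _).1 ?_
    rw [LieHom.map_lie]
    exact congrArg Subtype.val h
  have hB : IsSolvable B := by
    refine LieIdeal.isSolvable_of_killingForm_apply_lie_eq_zero B fun x _ y hy ↦ ?_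
    have hy0 : LieAlgebra.ad K g y = 0 := by
      ext w
      have := hBB hy
      rw [LieModule.mem_maxTrivSubmodule] at this
      rw [LieAlgebra.ad_apply, ← lie_skew, this, neg_zero, LinearMap.zero_apply]
    rw [LieModule.traceForm_comm, killingForm_apply_apply, hy0]
    simp
  have hBZ : B ≤ center K g := by
    rw [← radical_eq_center]
    exact (LieIdeal.solvable_iff_le_radical K g B).1 hB
  rw [LieSubmodule.eq_bot_iff]
  intro a ha
  obtain ⟨x, rfl⟩ := hπ a
  exact (hker x).2 (hBZ (LieIdeal.mem_comap.2 ha))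

/-- The derived algebra is a semisimple ideal: since `g` is the sum of its center and its derived
algebra, an abelian ideal of the derived algebra is an abelian ideal of `g`, so it is central. -/
lemma derived_le_semisimplePart :
    ⁅(⊤ : LieIdeal K g), (⊤ : LieIdeal K g)⁆ ≤ semisimplePart K g := by
  obtain ⟨π, hπ, hker⟩ := exists_semisimple_quotient K g
  set C := ⁅(⊤ : LieIdeal K g), (⊤ : LieIdeal K g)⁆ with hC
  refine le_sSup ((isSemisimple_iff_hasTrivialRadical _).2 ?_)
  rw [hasTrivialRadical_iff_no_abelian_ideals]
  intro A hA
  let A' : LieIdeal K g :=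
    { A.toSubmodule.map C.toSubmodule.subtype with
      lie_mem := by
        rintro x _ ⟨a, ha, rfl⟩
        have hx : x ∈ center K g ⊔ C := by rw [center_sup_derived_eq_top hπ hker]; trivial
        obtain ⟨z, hz, c, hc, rfl⟩ := (LieSubmodule.mem_sup _ _ _).1 hx
        refine ⟨⁅(⟨c, hc⟩ : C), a⁆, lie_mem_right K C A _ _ ha, ?_⟩
        rw [LieModule.mem_maxTrivSubmodule] at hz
        have : ⁅z, (a : g)⁆ = 0 := by rw [← lie_skew, hz, neg_zero]
        exact (by rw [add_lie, this, zero_add] : ⁅c, (a : g)⁆ = ⁅z + c, (a : g)⁆) }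
  have hA' : IsLieAbelian A' := by
    refine ⟨?_⟩
    rintro ⟨_, a, ha, rfl⟩ ⟨_, b, hb, rfl⟩
    have h := trivial_lie_zero A A ⟨a, ha⟩ ⟨b, hb⟩
    ext
    simpa using congrArg (fun t : A ↦ ((t : C) : g)) h
  have hZ : A' ≤ center K g := by
    rw [← radical_eq_center]
    exact (LieIdeal.solvable_iff_le_radical K g A').1 inferInstance
  rw [LieSubmodule.eq_bot_iff]
  intro a ha
  have := center_inf_derived hπ hker (hZ (show (a : g) ∈ A' from ⟨a, ha, rfl⟩)) a.2
  simpa using this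

lemma lie_mem_semisimplePart (x y : g) : ⁅x, y⁆ ∈ semisimplePart K g :=
  derived_le_semisimplePart (LieSubmodule.lie_mem_lie (by trivial) (by trivial))

variable (K g) in
/-- A reductive Lie algebra is the direct sum of its center and its maximal semisimple ideal. -/
lemma isCompl_center_semisimplePart :
    IsCompl (center K g).toSubmodule (semisimplePart K g).toSubmodule := by
  refine IsCompl.of_eq ?_ ?_
  · rw [Submodule.eq_bot_iff]
    rintro x ⟨hxZ, hxS⟩
    refine centralizer_inf_eq_zero hxS fun y _ ↦ ?_
    rw [SetLike.mem_coe, LieSubmodule.mem_toSubmodule, LieModule.mem_maxTrivSubmodule] at hxZ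
    rw [← lie_skew, hxZ, neg_zero]
  · obtain ⟨π, hπ, hker⟩ := exists_semisimple_quotient K g
    rw [← LieSubmodule.sup_toSubmodule, LieSubmodule.toSubmodule_eq_top, eq_top_iff,
      ← center_sup_derived_eq_top hπ hker]
    exact sup_le_sup_left derived_le_semisimplePart _

end Reductive

/-! ### Root spaces of a semisimple Lie algebra -/

section Roots

variable {K : Type*} {L : Type*} [Field K] [IsAlgClosed K] [CharZero K] [LieRing L] [LieAlgebra K L]
  [FiniteDimensional K L] [HasTrivialRadical K L] {H : LieSubalgebra K L} [H.IsCartanSubalgebra]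

open LieModule

variable (H) in
/-- A Cartan subalgebra contains a regular element. -/
lemma exists_forall_root_apply_ne_zero :
    ∃ h : H, ∀ α : Weight K H L, α.IsNonZero → α h ≠ 0 := by
  obtain ⟨h, hh⟩ := Module.Dual.exists_forall_ne_zero_of_forall_exists
    (fun α : H.root ↦ (rootSystem H).root α) fun α ↦ ⟨(rootSystem H).coroot α, by
      simpa using (by simp [root_apply_coroot (H.isNonZero_coe_root α)] :
        (α : Weight K H L) (coroot (α : Weight K H L)) ≠ 0)⟩
  exact ⟨h, fun α hα ↦ by simpa using hh ⟨α, by simpa using hα⟩⟩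

omit [CharZero K] [HasTrivialRadical K L] in
/-- Elements of a subspace normalised by `H` are sums of elements of weight spaces. -/
lemma weight_induction (N : Submodule K L) (hN : ∀ h ∈ H, ∀ x ∈ N, ⁅h, x⁆ ∈ N)
    {P : L → Prop} (h0 : P 0) (hadd : ∀ x y, P x → P y → P (x + y))
    (hw : ∀ α : Weight K H L, ∀ x ∈ N, x ∈ rootSpace H α → P x) : ∀ x ∈ N, P x := by
  let N' : LieSubmodule K H L := { N with lie_mem := fun {h x} hx ↦ hN h h.2 x hx }
  intro x hx
  have hx' : x ∈ N' := hx
  rw [eq_iSup_inf_genWeightSpace K H L N'] at hx'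
  exact LieSubmodule.iSup_induction _ (motive := P) hx' (fun α y hy ↦ hw α y hy.1 hy.2) h0 hadd

omit [IsAlgClosed K] [CharZero K] [HasTrivialRadical K L] in
lemma mem_of_mem_rootSpace_of_isZero {α : Weight K H L} (hα : α.IsZero) {x : L}
    (hx : x ∈ rootSpace H α) : x ∈ H := by
  rw [hα.eq, rootSpace_zero_eq] at hx
  exact hx

lemma lie_eq_smul {α : H → K} {x : L} (hx : x ∈ rootSpace H α) (h : H) :
    ⁅(h : L), x⁆ = α h • x := lie_eq_smul_of_mem_rootSpace hx h

/-- The centralizer of a regular element of a Cartan subalgebra is the Cartan subalgebra. -/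
lemma mem_of_lie_eq_zero {h₀ : H} (hreg : ∀ α : Weight K H L, α.IsNonZero → α h₀ ≠ 0) {x : L}
    (hx : ⁅(h₀ : L), x⁆ = 0) : x ∈ H := by
  refine weight_induction (H := H) (LinearMap.ker (LieAlgebra.ad K L (h₀ : L))) ?_ (zero_mem H)
    (fun _ _ ↦ add_mem) ?_ x hx
  · intro h hh y hy
    rw [LinearMap.mem_ker, LieAlgebra.ad_apply] at hy ⊢
    have h1 : ⁅(h₀ : L), h⁆ = 0 := congrArg Subtype.val (trivial_lie_zero H H h₀ ⟨h, hh⟩)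
    rw [leibniz_lie, hy, h1, lie_zero, zero_lie, add_zero]
  · intro α y hy hyα
    by_cases hα : α.IsZero
    · exact mem_of_mem_rootSpace_of_isZero hα hyα
    · rw [LinearMap.mem_ker, LieAlgebra.ad_apply, lie_eq_smul hyα] at hy
      rw [(smul_eq_zero.1 hy).resolve_left (hreg α hα)]
      exact zero_mem H

/-- The operator `ad h` is semisimple, so a generalized eigenvector `y` is an eigenvector. -/
lemma lie_sub_smul_eq_zero {h : H} {c : K} {x y : L} (hx : ⁅(h : L), x⁆ = c • x)
    (hy : ⁅(h : L), y⁆ - c • y = x) : x = 0 := by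
  have hss := (isSemisimple_ad_of_mem_isCartanSubalgebra (K := K) (H := H) h.2).isFinitelySemisimple
  have hmem : y ∈ (LieAlgebra.ad K L (h : L)).maxGenEigenspace c := by
    rw [Module.End.mem_maxGenEigenspace]
    refine ⟨2, ?_⟩
    have : (LieAlgebra.ad K L (h : L) - c • (1 : Module.End K L)) y = x := by simpa using hy
    rw [pow_two, Module.End.mul_apply, this]
    simp [hx]
  rw [hss.maxGenEigenspace_eq_eigenspace, Module.End.mem_eigenspace_iff, LieAlgebra.ad_apply] at hmem
  rw [← hy, hmem, sub_self]

/-- If `α + β` is a root then `[L_α, L_β] ≠ 0`, by the representation theory of `𝔰𝔩₂`. -/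
lemma exists_lie_ne_zero {α β γ : Weight K H L} (hα : α.IsNonZero)
    (hγ : (γ : H → K) = α + β) :
    ∃ x ∈ rootSpace H α, ∃ y ∈ rootSpace H β, ⁅x, y⁆ ≠ 0 := by
  obtain ⟨x, hx, x_ne0⟩ := (chainTop α β).exists_ne_zero
  obtain ⟨h, e, f, isSl2, he, hf⟩ := exists_isSl2Triple_of_weight_isNonZero hα
  obtain rfl := isSl2.h_eq_coroot hα he hf
  have prim : isSl2.HasPrimitiveVectorWith x (chainLength α β : K) :=
    have := lie_mem_genWeightSpace_of_mem_genWeightSpace he hx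
    ⟨x_ne0, (chainLength_smul _ _ hx).symm, by rwa [genWeightSpace_add_chainTop _ _ hα] at this⟩
  have htop : 1 ≤ chainTopCoeff α β := by
    have := (rootSpace_zsmul_add_ne_bot_iff α β hα 1).1 (by
      rw [one_smul, ← hγ]; exact γ.genWeightSpace_ne_bot)
    exact_mod_cast this.1
  obtain ⟨m, hm⟩ : ∃ m, chainTopCoeff α β = m + 1 := ⟨_, (Nat.sub_add_cancel htop).symm⟩
  have hle := chainTopCoeff_le_chainLength α β
  refine ⟨e, he, ((toEnd K L L f) ^ (m + 1)) x, ?_, ?_⟩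
  · have := toEnd_pow_apply_mem hf hx (m + 1)
    convert this using 2
    rw [coe_chainTop, hm]
    ext; simp
  · rw [prim.lie_e_pow_succ_toEnd_f]
    refine smul_ne_zero (mul_ne_zero (by exact_mod_cast m.succ_ne_zero) ?_)
      (prim.pow_toEnd_f_ne_zero_of_eq_nat rfl (by omega))
    rw [sub_ne_zero]
    exact_mod_cast (by omega : chainLength α β ≠ m)

lemma exists_smul_eq {α : Weight K H L} (hα : α.IsNonZero) {x y : L} (hx : x ∈ rootSpace H α)
    (hx0 : x ≠ 0) (hy : y ∈ rootSpace H α) : ∃ c : K, c • x = y := by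
  simpa using (finrank_eq_one_iff_of_nonzero' (⟨x, hx⟩ : rootSpace H α) (by simpa using hx0)).mp
      (finrank_rootSpace_eq_one _ hα) ⟨_, hy⟩

end Roots

/-! ### Derivations of subalgebras containing a Borel subalgebra -/

section Borel

variable {K : Type*} {L : Type*} [Field K] [IsAlgClosed K] [CharZero K] [LieRing L] [LieAlgebra K L]
  [FiniteDimensional K L] [HasTrivialRadical K L] {H : LieSubalgebra K L} [H.IsCartanSubalgebra]

open LieModule

lemma eq_zero_of_forall_mem_support (b : (rootSystem H).Base) {h : H}
    (hh : ∀ α ∈ b.support, (α : Weight K H L) h = 0) : h = 0 := by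
  refine (Module.forall_dual_apply_eq_zero_iff K h).1 fun l ↦ ?_
  have : l ∈ Submodule.span K ((rootSystem H).root '' b.support) := by
    rw [b.span_root_support, RootPairing.rootSpan, RootPairing.IsRootSystem.span_root_eq_top]
    trivial
  induction this using Submodule.span_induction with
  | mem x hx =>
    obtain ⟨α, hα, rfl⟩ := hx
    simpa using hh α hα
  | zero => rfl
  | add x y _ _ hx hy => simp [hx, hy]
  | smul c x _ hx => simp [hx]

/-- The values of the simple roots on `H` may be prescribed. -/
lemma exists_forall_mem_support_eq (b : (rootSystem H).Base) (c : H.root → K) :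
    ∃ h : H, ∀ α ∈ b.support, (α : Weight K H L) h = c α := by
  let l : Module.Dual K (Module.Dual K H) := b.toWeightBasis.constr K fun i ↦ c i
  refine ⟨(Module.evalEquiv K H).symm l, fun α hα ↦ ?_⟩
  have h1 : l ((rootSystem H).root α) = c α := by
    have := b.toWeightBasis.constr_basis K (fun i ↦ c i) ⟨α, hα⟩
    rwa [RootPairing.Base.toWeightBasis_apply] at this
  rw [← h1]
  conv_rhs => rw [← (Module.evalEquiv K H).apply_symm_apply l]
  rfl

/-- A Lie subalgebra containing the Borel subalgebra given by `H` and the base `b`. -/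
structure ContainsBorel (b : (rootSystem H).Base) (p : LieSubalgebra K L) : Prop where
  cartan_le : H ≤ p
  mem_of_isPos : ∀ α : H.root, b.IsPos α → ∀ x ∈ rootSpace H (α : Weight K H L), x ∈ p

variable {b : (rootSystem H).Base} {p : LieSubalgebra K L}

lemma IsBorel.exists_containsBorel {B : LieSubalgebra K L} (hB : IsBorel B) (h : B ≤ p) :
    ∃ (H : LieSubalgebra K L) (_ : H.IsCartanSubalgebra) (b : (rootSystem H).Base),
      ContainsBorel b p := by
  obtain ⟨H, hH, b, hb⟩ := hB
  refine ⟨H, hH, b, fun x hx ↦ h ?_, fun α hα x hx ↦ h ?_⟩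
  · rw [← LieSubalgebra.mem_toSubmodule, hb]
    exact Submodule.mem_sup_left hx
  · rw [← LieSubalgebra.mem_toSubmodule, hb]
    exact Submodule.mem_sup_right (Submodule.mem_iSup_of_mem α (Submodule.mem_iSup_of_mem hα hx))

/-- The centralizer of a Borel subalgebra is trivial. -/
lemma ContainsBorel.eq_zero_of_forall_lie_eq_zero (hp : ContainsBorel b p) {x : L}
    (hx : ∀ y ∈ p, ⁅x, y⁆ = 0) : x = 0 := by
  obtain ⟨h₀, hreg⟩ := exists_forall_root_apply_ne_zero H
  have hxH : x ∈ H := mem_of_lie_eq_zero hreg (by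
    rw [← lie_skew, hx _ (hp.cartan_le h₀.2), neg_zero])
  have : (⟨x, hxH⟩ : H) = 0 := by
    refine eq_zero_of_forall_mem_support b fun α hα ↦ ?_
    obtain ⟨e, he, he0⟩ := (α : Weight K H L).exists_ne_zero
    have h1 := lie_eq_smul he ⟨x, hxH⟩
    rw [hx e (hp.mem_of_isPos α (RootPairing.Base.isPos_of_mem_support hα) e he)] at h1
    exact (smul_eq_zero.1 h1.symm).resolve_right he0
  exact congrArg Subtype.val this

/-- `p = H + ⁅h₀, p⁆` for a regular element `h₀`, which acts on each root space by a nonzero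
scalar. -/
lemma exists_lie_add {h₀ : H} (hreg : ∀ α : Weight K H L, α.IsNonZero → α h₀ ≠ 0) (hH : H ≤ p)
    {x : L} (hx : x ∈ p) : ∃ a ∈ H, ∃ v ∈ p, x = a + ⁅(h₀ : L), v⁆ := by
  refine weight_induction (H := H) p.toSubmodule (fun h hh y hy ↦ p.lie_mem (hH hh) hy)
    (P := fun x ↦ ∃ a ∈ H, ∃ v ∈ p, x = a + ⁅(h₀ : L), v⁆) ?_ ?_ ?_ x hx
  · exact ⟨0, zero_mem _, 0, zero_mem _, by simp⟩
  · rintro _ _ ⟨a, ha, v, hv, rfl⟩ ⟨a', ha', v', hv', rfl⟩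
    exact ⟨a + a', add_mem ha ha', v + v', add_mem hv hv', by rw [lie_add]; abel⟩
  · intro α y hy hyα
    by_cases hα : α.IsZero
    · exact ⟨y, mem_of_mem_rootSpace_of_isZero hα hyα, 0, zero_mem _, by simp⟩
    · refine ⟨0, zero_mem _, (α h₀)⁻¹ • y, p.smul_mem _ hy, ?_⟩
      rw [lie_smul, lie_eq_smul hyα, smul_smul, inv_mul_cancel₀ (hreg α hα), one_smul, zero_add]

omit [IsAlgClosed K] [CharZero K] [FiniteDimensional K L] [HasTrivialRadical K L] in
lemma coe_derivation_lie (D : LieDerivation K p p) (x y : p) :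
    (D ⁅x, y⁆ : L) = ⁅(D x : L), (y : L)⁆ + ⁅(x : L), (D y : L)⁆ := by
  rw [LieDerivation.apply_lie_eq_add, add_comm]
  rfl

/-- Subtracting an inner derivation, one may assume that a derivation of `p` preserves `H`: the
component of `D h₀` outside `H`, for a regular `h₀`, is `⁅h₀, v⁆`, and an element commuting with
`h₀` lies in `H`. -/
lemma exists_sub_ad_mem_cartan (hH : H ≤ p) (D : LieDerivation K p p) :
    ∃ v : p, ∀ h : p, (h : L) ∈ H → ((D - LieDerivation.ad K p v) h : L) ∈ H := by
  obtain ⟨h₀, hreg⟩ := exists_forall_root_apply_ne_zero H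
  let h₁ : p := ⟨h₀, hH h₀.2⟩
  obtain ⟨a, ha, v, hv, hav⟩ := exists_lie_add hreg hH (D h₁).2
  refine ⟨-⟨v, hv⟩, fun h hh ↦ ?_⟩
  set E := D - LieDerivation.ad K p (-⟨v, hv⟩) with hE
  have hE₀ : (E h₁ : L) = a := by
    have : (E h₁ : L) = (D h₁ : L) - ⁅-v, (h₀ : L)⁆ := by
      simp only [hE, LieDerivation.sub_apply, map_neg, LieDerivation.neg_apply]
      simp [h₁]
    rw [this, hav, neg_lie, ← lie_skew v]
    abel
  have hcomm : ∀ x ∈ H, ∀ y ∈ H, ⁅x, y⁆ = 0 := fun x hx y hy ↦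
    congrArg Subtype.val (trivial_lie_zero H H ⟨x, hx⟩ ⟨y, hy⟩)
  refine mem_of_lie_eq_zero hreg ?_
  have h1 := coe_derivation_lie E h₁ h
  have h2 : ⁅h₁, h⁆ = 0 := Subtype.ext (hcomm _ h₀.2 _ hh)
  rw [h2, map_zero, hE₀, hcomm a ha _ hh, zero_add] at h1
  exact h1.symm

/-- A derivation `D` of `p` that preserves `H` kills `H`. For a simple root vector `e` and `h ∈ H`, the
Leibniz rule gives `⁅h, D e⁆ - α h • D e = -α (D h) • e`; as `ad h` is semisimple, `α (D h) = 0`. -/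
lemma ContainsBorel.derivation_eq_zero_of_mem_cartan (hp : ContainsBorel b p)
    {D : LieDerivation K p p} (hD : ∀ h : p, (h : L) ∈ H → (D h : L) ∈ H) {h : p}
    (hh : (h : L) ∈ H) : D h = 0 := by
  have : (⟨D h, hD h hh⟩ : H) = 0 := by
    refine eq_zero_of_forall_mem_support b fun α hα ↦ ?_
    obtain ⟨e, he, he0⟩ := (α : Weight K H L).exists_ne_zero
    let e' : p := ⟨e, hp.mem_of_isPos α (RootPairing.Base.isPos_of_mem_support hα) e he⟩
    have h1 := coe_derivation_lie D h e'
    have h2 : ⁅h, e'⁆ = (α : Weight K H L) ⟨h, hh⟩ • e' := Subtype.ext (lie_eq_smul he ⟨h, hh⟩)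
    have h3 : ⁅(D h : L), (e' : L)⁆ = (α : Weight K H L) ⟨D h, hD h hh⟩ • e :=
      lie_eq_smul he ⟨D h, hD h hh⟩
    rw [h2, map_smul, h3] at h1
    have h4 := lie_sub_smul_eq_zero (H := H) (h := ⟨h, hh⟩) (c := (α : Weight K H L) ⟨h, hh⟩)
      (x := -((α : Weight K H L) ⟨D h, hD h hh⟩ • e)) (y := D e')
      (by rw [lie_neg, lie_smul, lie_eq_smul he, smul_neg, smul_comm]) (by
        have : ((((α : Weight K H L) ⟨h, hh⟩) • D e' : p) : L)
          = ((α : Weight K H L) ⟨h, hh⟩) • (D e' : L) := rfl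
        rw [← this, h1]; simp)
    exact (smul_eq_zero.1 (neg_eq_zero.1 h4)).resolve_right he0
  have h0 : (D h : L) = 0 := congrArg (Subtype.val : H → L) this
  exact Subtype.ext h0

/-- A derivation of `p` that kills `H` preserves the root spaces. -/
lemma derivation_mem_rootSpace (hH : H ≤ p) {D : LieDerivation K p p}
    (hD : ∀ h : p, (h : L) ∈ H → D h = 0) {α : H → K} {x : p} (hx : (x : L) ∈ rootSpace H α) :
    (D x : L) ∈ rootSpace H α := by
  refine weightSpace_le_genWeightSpace L α ((mem_weightSpace α _).2 fun h ↦ ?_)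
  have h1 := coe_derivation_lie D ⟨h, hH h.2⟩ x
  have h2 : ⁅(⟨h, hH h.2⟩ : p), x⁆ = α h • x := Subtype.ext (lie_eq_smul hx h)
  rw [h2, hD ⟨h, hH h.2⟩ h.2, map_smul] at h1
  simpa using h1.symm

/-- A derivation `D` of `p` that kills `H` and the simple root vectors vanishes: it kills the positive
root spaces, which the simple root vectors generate. For `y ∈ p` in a negative root space and `e` in
the opposite one, `⁅e, y⁆ ∈ H` gives `⁅e, D y⁆ = 0`, so that `κ(D y, e) = 0`. -/
lemma ContainsBorel.derivation_eq_zero (hp : ContainsBorel b p) {D : LieDerivation K p p}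
    (hD : ∀ h : p, (h : L) ∈ H → D h = 0)
    (hs : ∀ α ∈ b.support, ∀ x : p, (x : L) ∈ rootSpace H (α : Weight K H L) → D x = 0) :
    D = 0 := by
  have hpos : ∀ α : H.root, b.IsPos α →
      ∀ x : p, (x : L) ∈ rootSpace H (α : Weight K H L) → D x = 0 := by
    intro α hα
    suffices b.IsPos α ∧ ∀ x : p, (x : L) ∈ rootSpace H (α : Weight K H L) → D x = 0 from this.2
    refine hα.induction_on_add (p := fun α ↦ b.IsPos α ∧
      ∀ x : p, (x : L) ∈ rootSpace H (α : Weight K H L) → D x = 0)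
      (fun β hβ ↦ ⟨RootPairing.Base.isPos_of_mem_support hβ, hs β hβ⟩) ?_
    rintro β γ δ hδ ⟨hβ, hβD⟩ hγ
    have hγp := RootPairing.Base.isPos_of_mem_support hγ
    have hδp := hβ.add hγp hδ
    refine ⟨hδp, fun x hx ↦ ?_⟩
    have hδ' : ((δ : Weight K H L) : H → K) = (β : Weight K H L) + (γ : Weight K H L) := by
      ext h
      simpa using LinearMap.congr_fun hδ h
    obtain ⟨y, hy, z, hz, hyz⟩ := exists_lie_ne_zero (H.isNonZero_coe_root β) hδ'
    have hmem : ⁅y, z⁆ ∈ rootSpace H (δ : Weight K H L) := by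
      rw [hδ']; exact lie_mem_genWeightSpace_of_mem_genWeightSpace hy hz
    obtain ⟨c, hc⟩ := exists_smul_eq (H.isNonZero_coe_root δ) hmem hyz hx
    let y' : p := ⟨y, hp.mem_of_isPos β hβ y hy⟩
    let z' : p := ⟨z, hp.mem_of_isPos γ hγp z hz⟩
    have : x = c • ⁅y', z'⁆ := Subtype.ext hc.symm
    rw [this, map_smul, LieDerivation.apply_lie_eq_add, hβD y' hy, hs γ hγ z' hz]
    simp
  have hall : ∀ x (hx : x ∈ p), D ⟨x, hx⟩ = 0 := by
    intro x hx
    suffices ∃ hx : x ∈ p, D ⟨x, hx⟩ = 0 from this.2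
    refine weight_induction (H := H) p.toSubmodule
      (fun h hh y hy ↦ p.lie_mem (hp.cartan_le hh) hy)
      (P := fun x ↦ ∃ hx : x ∈ p, D ⟨x, hx⟩ = 0) ⟨zero_mem _, map_zero D⟩ ?_ ?_ x hx
    · rintro x y ⟨hx, hx0⟩ ⟨hy, hy0⟩
      exact ⟨add_mem hx hy, (map_add D ⟨x, hx⟩ ⟨y, hy⟩).trans (by rw [hx0, hy0, add_zero])⟩
    · intro α y hy hyα
      refine ⟨hy, ?_⟩
      by_cases hα : α.IsZero
      · exact hD _ (mem_of_mem_rootSpace_of_isZero hα hyα)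
      let α' : H.root := ⟨α, by simpa using hα⟩
      rcases RootPairing.Base.IsPos.or_neg b α' with h | h
      · exact hpos α' h _ hyα
      -- The Killing form pairs the opposite root space nondegenerately with that of `D y`.
      have hDy := derivation_mem_rootSpace hp.cartan_le hD (x := ⟨y, hy⟩) hyα
      refine Subtype.ext ?_
      have hker := mem_ker_killingForm_of_mem_rootSpace_of_forall_rootSpace_neg K L H hDy ?_
      · simpa using hker
      intro e he
      let := (rootSystem H).indexNeg
      have hneg : (((-α' : H.root) : Weight K H L) : H → K) = -α := by
        ext t
        have : (rootSystem H).root (-α') = -(rootSystem H).root α' :=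
          ((rootSystem H).root_reflectionPerm α' α').trans ((rootSystem H).reflection_apply_self α')
        exact LinearMap.congr_fun this t
      have heneg : e ∈ rootSpace H ((-α' : H.root) : Weight K H L) := by rwa [hneg]
      let e' : p := ⟨e, hp.mem_of_isPos _ h e heneg⟩
      have h0 : D ⁅e', ⟨y, hy⟩⁆ = 0 := by
        refine hD _ ?_
        have hmem : ⁅e, y⁆ ∈ rootSpace H (-α + α : H → K) :=
          lie_mem_genWeightSpace_of_mem_genWeightSpace he hyα
        rw [neg_add_cancel, rootSpace_zero_eq] at hmem
        exact hmem
      have h1 := coe_derivation_lie D e' ⟨y, hy⟩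
      rw [h0, hpos _ h e' heneg, ZeroMemClass.coe_zero, zero_lie, zero_add] at h1
      have h2 := lie_eq_killingForm_smul_of_mem_rootSpace_of_mem_rootSpace_neg hDy he
      have h3 : ⁅(D ⟨y, hy⟩ : L), e⁆ = 0 := by rw [← lie_skew]; exact neg_eq_zero.2 h1.symm
      rw [h3] at h2
      refine (smul_eq_zero.1 h2.symm).resolve_right fun h4 ↦ ?_
      refine root_apply_cartanEquivDual_symm_ne_zero hα ?_
      have h5 : (cartanEquivDual H).symm α.toLinear = 0 := Subtype.ext h4
      rw [h5, ← Weight.toLinear_apply, map_zero]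
  exact LieDerivation.ext fun x ↦ hall x x.2

/-- Every derivation of a subalgebra containing a Borel subalgebra is inner. Up to an inner derivation
it kills `H`, so that it acts on the simple root spaces by scalars, which are the values of the
simple roots at some element of `H`. -/
theorem ContainsBorel.exists_eq_ad (hp : ContainsBorel b p) (D : LieDerivation K p p) :
    ∃ u : p, LieDerivation.ad K p u = D := by
  obtain ⟨v, hv⟩ := exists_sub_ad_mem_cartan hp.cartan_le D
  set E := D - LieDerivation.ad K p v with hE
  have hE0 : ∀ h : p, (h : L) ∈ H → E h = 0 := fun h hh ↦
    hp.derivation_eq_zero_of_mem_cartan hv hh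
  have hc : ∀ α : H.root, ∃ c : K, α ∈ b.support → ∀ x : p,
      (x : L) ∈ rootSpace H (α : Weight K H L) → E x = c • x := by
    intro α
    by_cases hα : α ∈ b.support
    swap
    · exact ⟨0, fun h ↦ absurd h hα⟩
    obtain ⟨e, he, he0⟩ := (α : Weight K H L).exists_ne_zero
    let e' : p := ⟨e, hp.mem_of_isPos α (RootPairing.Base.isPos_of_mem_support hα) e he⟩
    obtain ⟨c, hc⟩ := exists_smul_eq (H.isNonZero_coe_root α) he he0
      (derivation_mem_rootSpace hp.cartan_le hE0 (x := e') he)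
    have hc' : E e' = c • e' := Subtype.ext hc.symm
    refine ⟨c, fun _ x hx ↦ ?_⟩
    obtain ⟨t, ht⟩ := exists_smul_eq (H.isNonZero_coe_root α) he he0 hx
    have ht' : x = t • e' := Subtype.ext ht.symm
    rw [ht', map_smul, hc', smul_comm]
  choose c hc using hc
  obtain ⟨h, hh⟩ := exists_forall_mem_support_eq b c
  let h' : p := ⟨h, hp.cartan_le h.2⟩
  have hF : E - LieDerivation.ad K p h' = 0 := by
    refine hp.derivation_eq_zero ?_ ?_
    · intro t ht
      have h0 : ⁅(h : L), (t : L)⁆ = 0 := congrArg Subtype.val (trivial_lie_zero H H h ⟨t, ht⟩)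
      have : ⁅h', t⁆ = 0 := Subtype.ext h0
      simp [hE0 t ht, this]
    · intro α hα x hx
      have : ⁅h', x⁆ = c α • x := by
        rw [← hh α hα]
        exact Subtype.ext (lie_eq_smul hx h)
      simp [hc α hα x hx, this]
  refine ⟨v + h', ?_⟩
  rw [map_add]
  rw [sub_eq_zero] at hF
  rw [← hF, hE]
  abel

end Borel

/-! ### Derivations with central values -/

section CentralDerivations

variable (K L : Type*) [Field K] [LieRing L] [LieAlgebra K L]

variable {K L} in
lemma derivation_mem_center (D : LieDerivation K L L) {x : L} (hx : x ∈ center K L) :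
    D x ∈ center K L := by
  rw [LieModule.mem_maxTrivSubmodule] at hx ⊢
  intro y
  have h := D.apply_lie_eq_add y x
  rw [hx, hx, add_zero, map_zero] at h
  exact h.symm

/-- The ideal of derivations with values in the center. -/
def centralDerivations : LieIdeal K (LieDerivation K L L) where
  carrier := {D | ∀ x, D x ∈ center K L}
  add_mem' hD hE x := add_mem (hD x) (hE x)
  zero_mem' _ := zero_mem _
  smul_mem' c _ hD x := (center K L).smul_mem c (hD x)
  lie_mem {E _} hD x := sub_mem (derivation_mem_center E (hD x)) (hD (E x))

variable {K L}

lemma lie_eq_zero_of_mem_center {x : L} (hx : x ∈ center K L) (y : L) : ⁅x, y⁆ = 0 := by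
  rw [← lie_skew, (LieModule.mem_maxTrivSubmodule K L L x).1 hx, neg_zero]

lemma apply_eq_zero_of_mem_derived {D : LieDerivation K L L} (hD : D ∈ centralDerivations K L)
    {x : L} (hx : x ∈ ⁅(⊤ : LieIdeal K L), (⊤ : LieIdeal K L)⁆) : D x = 0 := by
  rw [← LieSubmodule.mem_toSubmodule, LieSubmodule.lieIdeal_oper_eq_linear_span'] at hx
  induction hx using Submodule.span_induction with
  | mem y hy =>
    obtain ⟨a, -, b, -, rfl⟩ := hy
    rw [D.apply_lie_eq_add, lie_eq_zero_of_mem_center (hD a),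
      (LieModule.mem_maxTrivSubmodule K L L _).1 (hD b), add_zero]
  | zero => exact map_zero D
  | add y z _ _ hy hz => rw [map_add, hy, hz, add_zero]
  | smul c y _ hy => rw [map_smul, hy, smul_zero]

/-- An element of `centralMaps`, as a derivation. -/
def derivationOfMemCentralMaps {f : L →ₗ[K] L} (hf : f ∈ centralMaps K L) : LieDerivation K L L where
  __ := f
  leibniz' x y := by
    change f ⁅x, y⁆ = ⁅x, f y⁆ - ⁅y, f x⁆
    rw [hf.2 _ (LieSubmodule.lie_mem_lie (by trivial) (by trivial)),
      (LieModule.mem_maxTrivSubmodule K L L _).1 (hf.1 y),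
      (LieModule.mem_maxTrivSubmodule K L L _).1 (hf.1 x), sub_zero]

lemma mem_centralMaps_iff_exists {f : L →ₗ[K] L} :
    f ∈ centralMaps K L ↔ ∃ D ∈ centralDerivations K L, (D : L →ₗ[K] L) = f := by
  constructor
  · intro hf
    exact ⟨derivationOfMemCentralMaps hf, hf.1, rfl⟩
  · rintro ⟨D, hD, rfl⟩
    exact ⟨hD, fun x hx ↦ apply_eq_zero_of_mem_derived hD hx⟩

end CentralDerivations

/-! ### Derivations of parabolic subalgebras of reductive Lie algebras -/

section Parabolic

variable {K : Type*} {g : Type*} [Field K] [LieRing g] [LieAlgebra K g]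

/-- The inclusion of `q ∩ g_S` into `q`. -/
def semisimpleInterIncl (q : LieSubalgebra K g) : semisimpleInter q →ₗ⁅K⁆ q where
  toFun u := ⟨((u : semisimplePart K g) : g), u.2⟩
  map_add' _ _ := rfl
  map_smul' _ _ := rfl
  map_lie' := rfl

variable [CharZero K] [FiniteDimensional K g] [HasCentralRadical K g]

variable (K g) in
lemma exists_projection_semisimplePart : ∃ P : g →ₗ[K] semisimplePart K g,
    (∀ s : semisimplePart K g, P s = s) ∧ ∀ x, x - P x ∈ center K g := by
  have hc := (isCompl_center_semisimplePart K g).symm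
  refine ⟨Submodule.projectionOnto _ _ hc, Submodule.projectionOnto_apply_left hc, fun x ↦ ?_⟩
  have h1 := Submodule.projectionOnto_apply_left hc (Submodule.projectionOnto _ _ hc x)
  have h2 : x - Submodule.projectionOnto _ _ hc x ∈
      LinearMap.ker (Submodule.projectionOnto _ _ hc) := by
    rw [LinearMap.mem_ker, map_sub, h1, sub_self]
  rwa [Submodule.ker_projectionOnto hc] at h2

lemma eq_zero_of_mem_center_of_mem_semisimplePart {x : g} (hx : x ∈ center K g)
    (hx' : x ∈ semisimplePart K g) : x = 0 := by
  have := (isCompl_center_semisimplePart K g).disjoint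
  rw [Submodule.disjoint_def] at this
  exact this x hx hx'

variable [IsAlgClosed K] {q : LieSubalgebra K g}

/-- `q = g_Z + (q ∩ g_S)`. -/
lemma IsParabolic.exists_sub_mem_center (hq : IsParabolic q) (x : q) :
    ∃ u : semisimpleInter q, (x : g) - (semisimpleInterIncl q u : g) ∈ center K g := by
  obtain ⟨P, -, hP⟩ := exists_projection_semisimplePart K g
  refine ⟨⟨P x, ?_⟩, hP x⟩
  have : (x : g) - (x - P x) ∈ q := sub_mem x.2 (hq.center_le _ (hP x))
  rw [sub_sub_cancel] at this
  exact this

omit [HasCentralRadical K g] in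
lemma IsParabolic.exists_containsBorel (hq : IsParabolic q) :
    ∃ (H : LieSubalgebra K (semisimplePart K g)) (_ : H.IsCartanSubalgebra)
      (b : (rootSystem H).Base), ContainsBorel b (semisimpleInter q) := by
  obtain ⟨B, hB, hBq⟩ := hq.exists_borel_le
  exact hB.exists_containsBorel hBq

omit [HasCentralRadical K g] in
lemma IsParabolic.eq_zero_of_forall_lie_eq_zero (hq : IsParabolic q) {u : semisimpleInter q}
    (hu : ∀ v : semisimpleInter q, ⁅u, v⁆ = 0) : u = 0 := by
  obtain ⟨H, _, b, hb⟩ := hq.exists_containsBorel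
  have : (u : semisimplePart K g) = 0 := hb.eq_zero_of_forall_lie_eq_zero fun y hy ↦
    congrArg Subtype.val (hu ⟨y, hy⟩)
  exact Subtype.ext this

lemma IsParabolic.mem_center_iff (hq : IsParabolic q) (x : q) :
    x ∈ center K q ↔ (x : g) ∈ center K g := by
  constructor
  · intro hx
    obtain ⟨u, hu⟩ := hq.exists_sub_mem_center x
    have hu0 : u = 0 := by
      refine hq.eq_zero_of_forall_lie_eq_zero fun v ↦ ?_
      have h1 := congrArg Subtype.val (lie_eq_zero_of_mem_center hx (semisimpleInterIncl q v))
      have h2 := lie_eq_zero_of_mem_center hu (semisimpleInterIncl q v : g)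
      rw [sub_lie, sub_eq_zero] at h2
      exact Subtype.ext (Subtype.ext (h2.symm.trans h1))
    rw [hu0, map_zero, ZeroMemClass.coe_zero, sub_zero] at hu
    exact hu
  · intro hx
    rw [LieModule.mem_maxTrivSubmodule] at hx ⊢
    exact fun y ↦ Subtype.ext (hx y)

omit [HasCentralRadical K g] in
lemma IsParabolic.eq_zero_of_mem_center (hq : IsParabolic q) {u : semisimpleInter q}
    (hu : semisimpleInterIncl q u ∈ center K q) : u = 0 :=
  hq.eq_zero_of_forall_lie_eq_zero fun v ↦ Subtype.ext (Subtype.ext (congrArg (Subtype.val : q → g)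
    (lie_eq_zero_of_mem_center hu (semisimpleInterIncl q v))))

/-- Up to an inner derivation given by an element of `q ∩ g_S`, every derivation `D` of a parabolic
subalgebra has values in the center: followed by the projection to `g_S`, it restricts to a derivation
of `q ∩ g_S`, which is inner. -/
lemma IsParabolic.exists_sub_ad_mem (hq : IsParabolic q) (D : LieDerivation K q q) :
    ∃ u : semisimpleInter q,
      D - LieDerivation.ad K q (semisimpleInterIncl q u) ∈ centralDerivations K q := by
  obtain ⟨P, hPS, hPZ⟩ := exists_projection_semisimplePart K g
  have hPq : ∀ x : q, P x ∈ semisimpleInter q := by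
    intro x
    have : (x : g) - (x - P x) ∈ q := sub_mem x.2 (hq.center_le _ (hPZ x))
    rw [sub_sub_cancel] at this
    exact this
  have hPlie : ∀ x y : g, ⁅(P x : g), y⁆ = ⁅x, y⁆ := fun x y ↦ by
    have := lie_eq_zero_of_mem_center (hPZ x) y
    rw [sub_lie, sub_eq_zero] at this
    exact this.symm
  let P' : q →ₗ[K] semisimpleInter q := (P.comp q.toSubmodule.subtype).codRestrict
    (semisimpleInter q).toSubmodule hPq
  let d : semisimpleInter q →ₗ[K] semisimpleInter q :=
    P' ∘ₗ (D : q →ₗ[K] q) ∘ₗ (semisimpleInterIncl q : semisimpleInter q →ₗ[K] q)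
  have hd : ∀ s, ((d s : semisimplePart K g) : g) = P (D (semisimpleInterIncl q s) : g) :=
    fun s ↦ rfl
  let DS : LieDerivation K (semisimpleInter q) (semisimpleInter q) :=
    { d with
      leibniz' := fun s t ↦ by
        refine Subtype.ext (Subtype.ext ?_)
        have h1 := coe_derivation_lie D (semisimpleInterIncl q s) (semisimpleInterIncl q t)
        have h2 : P ⁅(D (semisimpleInterIncl q s) : g), (semisimpleInterIncl q t : g)⁆
          = ⁅(D (semisimpleInterIncl q s) : g), (semisimpleInterIncl q t : g)⁆ :=
          congrArg Subtype.val (hPS ⟨_, lie_mem_semisimplePart _ _⟩)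
        have h3 : P ⁅(semisimpleInterIncl q s : g), (D (semisimpleInterIncl q t) : g)⁆
          = ⁅(semisimpleInterIncl q s : g), (D (semisimpleInterIncl q t) : g)⁆ :=
          congrArg Subtype.val (hPS ⟨_, lie_mem_semisimplePart _ _⟩)
        change ((d ⁅s, t⁆ : semisimplePart K g) : g) =
          ⁅(semisimpleInterIncl q s : g), ((d t : semisimplePart K g) : g)⁆ -
          ⁅(semisimpleInterIncl q t : g), ((d s : semisimplePart K g) : g)⁆
        rw [hd, hd, hd, LieHom.map_lie, h1, map_add, Submodule.coe_add, h2, h3,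
          ← lie_skew _ (P _ : g), ← lie_skew _ (P _ : g), hPlie, hPlie,
          ← lie_skew _ (D (semisimpleInterIncl q t) : g)]
        abel }
  obtain ⟨H, _, b, hb⟩ := hq.exists_containsBorel
  obtain ⟨u, hu⟩ := hb.exists_eq_ad DS
  refine ⟨u, fun x ↦ ?_⟩
  set E := D - LieDerivation.ad K q (semisimpleInterIncl q u) with hE
  obtain ⟨s, hs⟩ := hq.exists_sub_mem_center x
  have hx : x = (x - semisimpleInterIncl q s) + semisimpleInterIncl q s := by abel
  rw [hx, map_add]
  refine add_mem (derivation_mem_center E ((hq.mem_center_iff _).2 hs)) ?_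
  rw [hq.mem_center_iff]
  have h1 : ((DS s : semisimplePart K g) : g) = ⁅(semisimpleInterIncl q u : g),
      (semisimpleInterIncl q s : g)⁆ := by
    rw [← hu]
    simp; rfl
  have h2 : (E (semisimpleInterIncl q s) : g) = (D (semisimpleInterIncl q s) : g) -
      ⁅(semisimpleInterIncl q u : g), (semisimpleInterIncl q s : g)⁆ := by
    simp [hE]
  rw [h2, ← h1]
  exact hPZ _

/-- An inner derivation with central values vanishes because `⁅g, g⁆ ≤ g_S` meets the center
trivially. -/
lemma IsParabolic.isCompl_centralDerivations (hq : IsParabolic q) :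
    IsCompl (centralDerivations K q) (LieDerivation.ad K q).idealRange := by
  refine IsCompl.of_eq ?_ ?_
  · rw [LieSubmodule.eq_bot_iff]
    rintro D ⟨hD, hD'⟩
    obtain ⟨x, rfl⟩ := LieDerivation.mem_ad_idealRange_iff.1 hD'
    ext y
    have h1 := (hq.mem_center_iff _).1 (hD y)
    simp at h1
    simpa using eq_zero_of_mem_center_of_mem_semisimplePart h1
      (lie_mem_semisimplePart (K := K) (x : g) (y : g))
  · rw [eq_top_iff]
    intro D _
    obtain ⟨u, hu⟩ := hq.exists_sub_ad_mem D
    rw [LieSubmodule.mem_sup]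
    exact ⟨_, hu, _, LieDerivation.mem_ad_idealRange_iff.2 ⟨_, rfl⟩, sub_add_cancel _ _⟩

end Parabolic

/-! ### Coroots and the derived algebra of a standard parabolic subalgebra -/

section Standard

variable {K : Type*} {L : Type*} [Field K] [IsAlgClosed K] [CharZero K] [LieRing L] [LieAlgebra K L]
  [FiniteDimensional K L] [HasTrivialRadical K L] {H : LieSubalgebra K L} [H.IsCartanSubalgebra]

open LieModule

/-- The span of the coroots of the simple roots outside `Δ'`, inside the semisimple algebra. -/
def simpleCorootSpan (b : (rootSystem H).Base) (Δ' : Set H.root) : Submodule K L :=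
  Submodule.span K {x : L | ∃ α ∈ (b.support : Set H.root) \ Δ', x = (rootSystem H).coroot α}

/-- The span of the brackets of elements of a subalgebra, as a subspace of the ambient algebra. -/
def bracketSpan {K L : Type*} [Field K] [LieRing L] [LieAlgebra K L] (p : LieSubalgebra K L) :
    Submodule K L :=
  Submodule.span K {m : L | ∃ x ∈ p, ∃ y ∈ p, ⁅x, y⁆ = m}

variable {b : (rootSystem H).Base} {Δ' : Set H.root} {p : LieSubalgebra K L}

/-- A property of elements of `H + ∑_{α ∈ Φ'} L_α` may be checked on the summands. -/
lemma standardParabolic_induction {P : L → Prop} (h0 : P 0)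
    (hadd : ∀ x y, P x → P y → P (x + y)) (hH : ∀ x ∈ H, P x)
    (hα : ∀ α ∈ standardRoots b Δ', ∀ x ∈ rootSpace H (α : Weight K H L), P x) :
    ∀ x ∈ standardParabolic b Δ', P x := by
  intro x hx
  obtain ⟨h, hh, y, hy, rfl⟩ := Submodule.mem_sup.1 hx
  refine hadd _ _ (hH h hh) ?_
  rw [← iSup_subtype''] at hy
  exact Submodule.iSup_induction _ (motive := P) hy (fun α y hy ↦ hα α α.2 y hy) h0 hadd

lemma mem_of_mem_standardRoots (hp : p.toSubmodule = standardParabolic b Δ') {α : H.root}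
    (hα : α ∈ standardRoots b Δ') {x : L} (hx : x ∈ rootSpace H (α : Weight K H L)) : x ∈ p := by
  rw [← LieSubalgebra.mem_toSubmodule, hp]
  exact Submodule.mem_sup_right (Submodule.mem_iSup_of_mem α (Submodule.mem_iSup_of_mem hα hx))

lemma cartan_le_of_eq_standardParabolic (hp : p.toSubmodule = standardParabolic b Δ') : H ≤ p := by
  intro x hx
  rw [← LieSubalgebra.mem_toSubmodule, hp]
  exact Submodule.mem_sup_left hx

lemma simpleCorootSpan_le_cartan : simpleCorootSpan b Δ' ≤ H.toSubmodule := by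
  refine Submodule.span_le.2 ?_
  rintro _ ⟨α, -, rfl⟩
  exact Subtype.property _

/-- The coroots of the roots in `Δ'` are brackets of opposite root vectors of `p`, and a root vector
`x` is half of its bracket with the coroot. -/
lemma le_simpleCorootSpan_sup_bracketSpan
    (hp : p.toSubmodule = standardParabolic b Δ') :
    p.toSubmodule ≤ simpleCorootSpan b Δ' ⊔ bracketSpan p := by
  have hHp := cartan_le_of_eq_standardParabolic hp
  intro x hx
  rw [hp] at hx
  refine standardParabolic_induction (P := fun x ↦ x ∈ simpleCorootSpan b Δ' ⊔ bracketSpan p)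
    (zero_mem _) (fun _ _ ↦ add_mem) ?_ ?_ x hx
  · intro h hh
    have hmem : (⟨h, hh⟩ : H) ∈ Submodule.span K ((rootSystem H).coroot '' b.support) := by
      rw [b.span_coroot_support, RootPairing.corootSpan,
        RootPairing.IsRootSystem.span_coroot_eq_top]
      trivial
    have hle : (Submodule.span K ((rootSystem H).coroot '' b.support)).map H.toSubmodule.subtype ≤
        simpleCorootSpan b Δ' ⊔ bracketSpan p := by
      rw [Submodule.map_span_le]
      rintro _ ⟨δ, hδ, rfl⟩
      by_cases hδ' : δ ∈ Δ'
      · refine Submodule.mem_sup_right ?_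
        have hne := H.isNonZero_coe_root δ
        obtain ⟨h, e, f, isSl2, he, hf⟩ := exists_isSl2Triple_of_weight_isNonZero hne
        have hco := isSl2.h_eq_coroot hne he hf
        let := (rootSystem H).indexNeg
        have hneg : (rootSystem H).root (-δ) = -(rootSystem H).root δ :=
          ((rootSystem H).root_reflectionPerm δ δ).trans ((rootSystem H).reflection_apply_self δ)
        have hnegw : (((-δ : H.root) : Weight K H L) : H → K) = -(δ : Weight K H L) := by
          ext t
          exact LinearMap.congr_fun hneg t
        have hδs : δ ∈ standardRoots b Δ' := Or.inl (RootPairing.Base.isPos_of_mem_support hδ)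
        have hδs' : -δ ∈ standardRoots b Δ' := by
          refine Or.inr ?_
          rw [hneg]
          exact neg_mem (Submodule.subset_span ⟨δ, hδ', rfl⟩)
        refine Submodule.subset_span ⟨e, mem_of_mem_standardRoots hp hδs he, f,
          mem_of_mem_standardRoots hp hδs' (by rwa [hnegw]), ?_⟩
        rw [isSl2.lie_e_f, hco]
        rfl
      · exact Submodule.mem_sup_left (Submodule.subset_span ⟨δ, ⟨hδ, hδ'⟩, rfl⟩)
    exact hle ⟨_, hmem, rfl⟩
  · intro α hα x hx
    refine Submodule.mem_sup_right ?_
    have h1 := lie_eq_smul hx (coroot (α : Weight K H L))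
    rw [root_apply_coroot (H.isNonZero_coe_root α)] at h1
    have h2 : x = (2 : K)⁻¹ • ⁅(coroot (α : Weight K H L) : L), x⁆ := by
      rw [h1, smul_smul, inv_mul_cancel₀ two_ne_zero, one_smul]
    rw [h2]
    exact Submodule.smul_mem _ _ (Submodule.subset_span
      ⟨_, hHp (Subtype.property _), x, mem_of_mem_standardRoots hp hα hx, rfl⟩)

/-- If `ω ∈ H` is annihilated by the roots in `Δ'`, then `κ(ω, ·)` vanishes on `⁅p, p⁆`: two root
vectors of `p` that pair nontrivially under `κ` belong to opposite roots, which lie in the span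
of `Δ'`. -/
lemma killingForm_eq_zero_of_mem_bracketSpan (hp : p.toSubmodule = standardParabolic b Δ') {ω : H}
    (hω : ∀ α ∈ Δ', (α : Weight K H L) ω = 0) {w : L} (hw : w ∈ bracketSpan p) :
    killingForm K L ω w = 0 := by
  have hspan : ∀ α : H.root, (rootSystem H).root α ∈
      Submodule.span K ((rootSystem H).root '' Δ') → (α : Weight K H L) ω = 0 := by
    intro α hα
    suffices ∀ l ∈ Submodule.span K ((rootSystem H).root '' Δ'), l ω = 0 from this _ hα
    intro l hl
    induction hl using Submodule.span_induction with
    | mem x hx =>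
      obtain ⟨β, hβ, rfl⟩ := hx
      exact hω β hβ
    | zero => rfl
    | add x y _ _ hx hy => simp [hx, hy]
    | smul c x _ hx => simp [hx]
  suffices h : ∀ x ∈ p, ∀ y ∈ p, killingForm K L ⁅(ω : L), x⁆ y = 0 by
    induction hw using Submodule.span_induction with
    | mem m hm =>
      obtain ⟨x, hx, y, hy, rfl⟩ := hm
      rw [← LieModule.traceForm_apply_lie_apply, h x hx y hy]
    | zero => simp
    | add x y _ _ hx hy => simp [hx, hy]
    | smul c x _ hx => simp [hx]
  intro x hx y hy
  rw [← LieSubalgebra.mem_toSubmodule, hp] at hx hy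
  refine standardParabolic_induction (b := b) (Δ' := Δ')
    (P := fun x ↦ killingForm K L ⁅(ω : L), x⁆ y = 0) (by simp)
    (fun x x' h h' ↦ by rw [lie_add, map_add, LinearMap.add_apply, h, h', add_zero]) ?_ ?_ x hx
  · intro h hh
    have : ⁅(ω : L), h⁆ = 0 := congrArg Subtype.val (trivial_lie_zero H H ω ⟨h, hh⟩)
    rw [this, map_zero, LinearMap.zero_apply]
  · intro α hα x hx
    rw [lie_eq_smul hx, map_smul, LinearMap.smul_apply]
    by_cases hαs : (rootSystem H).root α ∈ Submodule.span K ((rootSystem H).root '' Δ')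
    · rw [hspan α hαs, zero_smul]
    have hαp : b.IsPos α := hα.resolve_right hαs
    suffices killingForm K L x y = 0 by rw [this, smul_zero]
    refine standardParabolic_induction (b := b) (Δ' := Δ') (P := fun y ↦ killingForm K L x y = 0)
      (by simp) (fun y y' h h' ↦ by rw [map_add, h, h', add_zero]) ?_ ?_ y hy
    · intro h hh
      have hh' : h ∈ rootSpace H (0 : H → K) := by rw [rootSpace_zero_eq]; exact hh
      refine killingForm_apply_eq_zero_of_mem_rootSpace_of_add_ne_zero K L H hx hh' ?_
      rw [add_zero]
      exact H.isNonZero_coe_root α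
    · intro β hβ z hz
      refine killingForm_apply_eq_zero_of_mem_rootSpace_of_add_ne_zero K L H hx hz fun hαβ ↦ ?_
      let := (rootSystem H).indexNeg
      have hroot : (rootSystem H).root β = -(rootSystem H).root α := by
        rw [eq_neg_iff_add_eq_zero, add_comm]
        ext t
        exact congrFun hαβ t
      have hβα : β = -α := (rootSystem H).root.injective
        (hroot.trans (((rootSystem H).root_reflectionPerm α α).trans
          ((rootSystem H).reflection_apply_self α)).symm)
      rcases hβ with hβ | hβ
      · rw [hβα, RootPairing.Base.IsPos.neg_iff_not] at hβ
        exact hβ hαp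
      · rw [hroot, neg_mem_iff] at hβ
        exact hαs hβ

/-- The fundamental coweight `ω δ` pairs under `κ` to zero with all simple coroots except that of `δ`.
For `δ ∉ Δ'` it pairs to zero with `⁅p, p⁆`, so an element of the intersection has no component along
any simple coroot. -/
lemma simpleCorootSpan_inf_bracketSpan (hΔ' : Δ' ⊆ b.support)
    (hp : p.toSubmodule = standardParabolic b Δ') {x : L}
    (hx : x ∈ simpleCorootSpan b Δ') (hx' : x ∈ bracketSpan p) : x = 0 := by
  classical
  have hxH := simpleCorootSpan_le_cartan hx
  -- The fundamental coweights.
  choose ω hω using fun δ : H.root ↦ exists_forall_mem_support_eq b (Pi.single δ 1)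
  have hco : ∀ δ, ∀ β ∈ b.support, β ≠ δ →
      killingForm K L (ω δ) (coroot (β : Weight K H L)) = 0 := by
    intro δ β hβ hβδ
    rw [LieModule.traceForm_comm]
    have := traceForm_coroot (β : Weight K H L) (ω δ)
    rw [hω δ β hβ, Pi.single_eq_of_ne hβδ, smul_zero, smul_zero] at this
    exact this
  have hco' : ∀ δ ∈ b.support, killingForm K L (ω δ) (coroot (δ : Weight K H L)) ≠ 0 := by
    intro δ hδ
    rw [LieModule.traceForm_comm]
    have := traceForm_coroot (δ : Weight K H L) (ω δ)
    rw [hω δ δ hδ, Pi.single_eq_same] at this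
    have hne := root_apply_cartanEquivDual_symm_ne_zero (H.isNonZero_coe_root δ)
    intro h0
    have h1 : traceForm K H L (coroot (δ : Weight K H L)) (ω δ) = 0 := h0
    rw [h1] at this
    simp at this
    exact hne this
  have hzero : ∀ δ ∈ b.support, killingForm K L (ω δ) x = 0 := by
    intro δ hδ
    by_cases hδ' : δ ∈ Δ'
    · have hle : simpleCorootSpan b Δ' ≤ LinearMap.ker (killingForm K L (ω δ)) := by
        refine Submodule.span_le.2 ?_
        rintro _ ⟨β, hβ, rfl⟩
        exact hco δ β hβ.1 fun h ↦ hβ.2 (h ▸ hδ')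
      exact hle hx
    · refine killingForm_eq_zero_of_mem_bracketSpan hp (fun α hα ↦ ?_) hx'
      rw [hω δ α (hΔ' hα), Pi.single_eq_of_ne]
      rintro rfl
      exact hδ' hα
  set a := b.toCoweightBasis.repr ⟨x, hxH⟩ with ha
  have hsum : (⟨x, hxH⟩ : H) = ∑ β : b.support, a β • (rootSystem H).coroot β := by
    have := (b.toCoweightBasis.sum_repr ⟨x, hxH⟩).symm
    simpa only [RootPairing.Base.toCoweightBasis_apply] using this
  have hsum' : x = ∑ β : b.support, a β • (coroot (β.1 : Weight K H L) : L) := by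
    have := congrArg H.toSubmodule.subtype hsum
    rw [map_sum] at this
    exact this
  have ha0 : a = 0 := by
    ext δ
    have h := hzero δ δ.2
    rw [hsum', map_sum, Finset.sum_eq_single δ] at h
    · rw [map_smul, smul_eq_mul] at h
      exact (mul_eq_zero.1 h).resolve_right (hco' δ δ.2)
    · intro β _ hβ
      rw [map_smul, hco δ β β.2 fun h ↦ hβ (Subtype.ext h), smul_zero]
    · simp
  rw [hsum', ha0]
  simp

end Standard

/-! ### The decomposition of a parabolic subalgebra -/

section Decomposition

variable {K : Type*} {g : Type*} [Field K] [LieRing g] [LieAlgebra K g]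

lemma derivedSubspace_eq_bracketSpan (q : LieSubalgebra K g) :
    derivedSubspace q = bracketSpan q := by
  rw [derivedSubspace, LieSubmodule.lieIdeal_oper_eq_linear_span', Submodule.map_span, bracketSpan]
  congr 1
  ext m
  constructor
  · rintro ⟨_, ⟨x, -, y, -, rfl⟩, rfl⟩
    exact ⟨x, x.2, y, y.2, rfl⟩
  · rintro ⟨x, hx, y, hy, rfl⟩
    exact ⟨⁅(⟨x, hx⟩ : q), ⟨y, hy⟩⁆, ⟨⟨x, hx⟩, trivial, ⟨y, hy⟩, trivial, rfl⟩, rfl⟩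

lemma mem_derivedSubspace_iff {q : LieSubalgebra K g} (x : q) :
    (x : g) ∈ derivedSubspace q ↔ x ∈ ⁅(⊤ : LieIdeal K q), (⊤ : LieIdeal K q)⁆ := by
  constructor
  · rintro ⟨y, hy, hyx⟩
    rwa [← Subtype.ext hyx]
  · intro hx
    exact ⟨x, hx, rfl⟩

variable [IsAlgClosed K] [CharZero K] [FiniteDimensional K g]

lemma corootSpan_eq_map {H : LieSubalgebra K (semisimplePart K g)} [H.IsCartanSubalgebra]
    (b : (rootSystem H).Base) (Δ' : Set H.root) :
    corootSpan b Δ' = (simpleCorootSpan b Δ').map (semisimplePart K g).toSubmodule.subtype := by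
  rw [corootSpan, simpleCorootSpan, Submodule.map_span]
  congr 1
  ext m
  constructor
  · rintro ⟨α, hα, rfl⟩
    exact ⟨_, ⟨α, hα, rfl⟩, rfl⟩
  · rintro ⟨_, ⟨α, hα, rfl⟩, rfl⟩
    exact ⟨α, hα, rfl⟩

variable [HasCentralRadical K g] {q : LieSubalgebra K g}

/-- The derived algebra of `q = g_Z ⊕ (q ∩ g_S)` is that of `q ∩ g_S`. -/
lemma IsParabolic.derivedSubspace_eq_map (hq : IsParabolic q) :
    derivedSubspace q =
      (bracketSpan (semisimpleInter q)).map (semisimplePart K g).toSubmodule.subtype := by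
  rw [derivedSubspace_eq_bracketSpan, bracketSpan, bracketSpan, Submodule.map_span]
  congr 1
  ext m
  constructor
  · rintro ⟨x, hx, y, hy, rfl⟩
    obtain ⟨u, hu⟩ := hq.exists_sub_mem_center ⟨x, hx⟩
    obtain ⟨v, hv⟩ := hq.exists_sub_mem_center ⟨y, hy⟩
    refine ⟨⁅(u : semisimplePart K g), (v : semisimplePart K g)⁆, ⟨u, u.2, v, v.2, rfl⟩, ?_⟩
    have h1 := lie_eq_zero_of_mem_center hu y
    have h2 := lie_eq_zero_of_mem_center hv (semisimpleInterIncl q u : g)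
    rw [sub_lie, sub_eq_zero] at h1 h2
    change ⁅x, y⁆ = _ at h1
    rw [h1, ← lie_skew]
    change ⁅y, _⁆ = _ at h2
    rw [← lie_skew _ y, h2]
    rfl
  · rintro ⟨_, ⟨x, hx, y, hy, rfl⟩, rfl⟩
    exact ⟨x, hx, y, hy, rfl⟩

variable {H : LieSubalgebra K (semisimplePart K g)} [H.IsCartanSubalgebra]
  {b : (rootSystem H).Base} {Δ' : Set H.root}

omit [HasCentralRadical K g] in
lemma corootSpan_le_semisimplePart : corootSpan b Δ' ≤ (semisimplePart K g).toSubmodule := by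
  rw [corootSpan_eq_map]
  exact Submodule.map_subtype_le _ _

omit [IsAlgClosed K] in
lemma derivedSubspace_le_semisimplePart :
    derivedSubspace q ≤ (semisimplePart K g).toSubmodule := by
  rw [derivedSubspace_eq_bracketSpan]
  refine Submodule.span_le.2 ?_
  rintro _ ⟨x, -, y, -, rfl⟩
  exact lie_mem_semisimplePart x y

omit [IsAlgClosed K] [CharZero K] [FiniteDimensional K g] [HasCentralRadical K g] in
lemma derivedSubspace_le : derivedSubspace q ≤ q.toSubmodule :=
  Submodule.map_subtype_le _ _

omit [HasCentralRadical K g] in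
lemma corootSpan_le (hp : (semisimpleInter q).toSubmodule = standardParabolic b Δ') :
    corootSpan b Δ' ≤ q.toSubmodule := by
  rw [corootSpan_eq_map]
  rintro _ ⟨x, hx, rfl⟩
  exact cartan_le_of_eq_standardParabolic hp (simpleCorootSpan_le_cartan hx)

lemma IsParabolic.sup_eq (hq : IsParabolic q)
    (hp : (semisimpleInter q).toSubmodule = standardParabolic b Δ') :
    (center K g).toSubmodule ⊔ corootSpan b Δ' ⊔ derivedSubspace q = q.toSubmodule := by
  refine le_antisymm (sup_le (sup_le hq.center_le (corootSpan_le hp)) derivedSubspace_le) ?_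
  intro x hx
  obtain ⟨u, hu⟩ := hq.exists_sub_mem_center ⟨x, hx⟩
  have h1 := le_simpleCorootSpan_sup_bracketSpan hp u.2
  have h2 := Submodule.mem_map_of_mem (f := (semisimplePart K g).toSubmodule.subtype) h1
  rw [Submodule.map_sup, ← corootSpan_eq_map, ← hq.derivedSubspace_eq_map] at h2
  have h3 : x = (x - (semisimpleInterIncl q u : g)) + (semisimpleInterIncl q u : g) := by abel
  rw [h3, sup_assoc]
  exact add_mem (Submodule.mem_sup_left hu) (Submodule.mem_sup_right h2)

lemma IsParabolic.disjoint_corootSpan_derivedSubspace (hq : IsParabolic q)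
    (hΔ' : Δ' ⊆ b.support) (hp : (semisimpleInter q).toSubmodule = standardParabolic b Δ') :
    Disjoint (corootSpan b Δ') (derivedSubspace q) := by
  rw [Submodule.disjoint_def, corootSpan_eq_map, hq.derivedSubspace_eq_map]
  rintro _ ⟨x, hx, rfl⟩ ⟨y, hy, hyx⟩
  have : y = x := Subtype.ext hyx
  rw [simpleCorootSpan_inf_bracketSpan hΔ' hp hx (this ▸ hy), map_zero]

lemma IsParabolic.iSupIndep (hq : IsParabolic q) (hΔ' : Δ' ⊆ b.support)
    (hp : (semisimpleInter q).toSubmodule = standardParabolic b Δ') :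
    iSupIndep ![(center K g).toSubmodule, corootSpan b Δ', derivedSubspace q] := by
  have hCW := hq.disjoint_corootSpan_derivedSubspace hΔ' hp
  have hZ : Disjoint (center K g).toSubmodule (corootSpan b Δ' ⊔ derivedSubspace q) :=
    (isCompl_center_semisimplePart K g).disjoint.mono_right
      (sup_le corootSpan_le_semisimplePart derivedSubspace_le_semisimplePart)
  rw [iSupIndep_fin_three]
  refine ⟨hZ, ?_, ?_⟩
  · exact hCW.disjoint_sup_right_of_disjoint_sup_left (hZ.symm)
  · have := hCW.symm.disjoint_sup_right_of_disjoint_sup_left (by rw [sup_comm]; exact hZ.symm)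
    rwa [sup_comm] at this

lemma IsParabolic.mem_centralMaps_iff (hq : IsParabolic q)
    (hp : (semisimpleInter q).toSubmodule = standardParabolic b Δ') (f : q →ₗ[K] q) :
    f ∈ centralMaps K q ↔
        (∀ x : q, (x : g) ∈ (center K g).toSubmodule ⊔ corootSpan b Δ' → (f x : g) ∈ center K g) ∧
        (∀ x : q, (x : g) ∈ derivedSubspace q → f x = 0) := by
  constructor
  · rintro ⟨h1, h2⟩
    exact ⟨fun x _ ↦ (hq.mem_center_iff _).1 (h1 x),
      fun x hx ↦ h2 x ((mem_derivedSubspace_iff x).1 hx)⟩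
  · rintro ⟨h1, h2⟩
    refine ⟨fun x ↦ (hq.mem_center_iff _).2 ?_, fun x hx ↦ h2 x ((mem_derivedSubspace_iff x).2 hx)⟩
    have hx : (x : g) ∈ (center K g).toSubmodule ⊔ corootSpan b Δ' ⊔ derivedSubspace q := by
      rw [hq.sup_eq hp]; exact x.2
    obtain ⟨y, hy, w, hw, hyw⟩ := Submodule.mem_sup.1 hx
    have hwq : w ∈ q := derivedSubspace_le hw
    have hyq : y ∈ q := by
      rw [eq_sub_of_add_eq hyw]; exact sub_mem x.2 hwq
    have : x = ⟨y, hyq⟩ + ⟨w, hwq⟩ := Subtype.ext hyw.symm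
    rw [this, map_add, h2 ⟨w, hwq⟩ hw, add_zero]
    exact h1 ⟨y, hyq⟩ hy

end Decomposition

/-! ### The structure of the derivation algebra -/

section Equivalence

variable {K L M V₁ V₂ : Type*} [Field K] [LieRing L] [LieAlgebra K L] [LieRing M] [LieAlgebra K M]
  [AddCommGroup V₁] [Module K V₁] [AddCommGroup V₂] [Module K V₂]

/-- Projections onto the first two summands of a decomposition of a Lie algebra `L` as the sum of
its center, which is identified with `V₁`, a copy of `V₂`, and the derived algebra. -/
structure DerivedSplitting (K L V₁ V₂ : Type*) [Field K] [LieRing L] [LieAlgebra K L]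
    [AddCommGroup V₁] [Module K V₁] [AddCommGroup V₂] [Module K V₂] where
  /-- The inclusion of the center. -/
  incl₁ : V₁ →ₗ[K] L
  /-- The inclusion of the second summand. -/
  incl₂ : V₂ →ₗ[K] L
  /-- The projection onto the center. -/
  proj₁ : L →ₗ[K] V₁
  /-- The projection onto the second summand. -/
  proj₂ : L →ₗ[K] V₂
  incl₁_mem_center : ∀ v, incl₁ v ∈ center K L
  incl₁_proj₁ : ∀ x ∈ center K L, incl₁ (proj₁ x) = x
  proj₁_incl₁ : ∀ v, proj₁ (incl₁ v) = v
  proj₂_incl₁ : ∀ v, proj₂ (incl₁ v) = 0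
  proj₁_incl₂ : ∀ v, proj₁ (incl₂ v) = 0
  proj₂_incl₂ : ∀ v, proj₂ (incl₂ v) = v
  proj₁_lie : ∀ x y : L, proj₁ ⁅x, y⁆ = 0
  proj₂_lie : ∀ x y : L, proj₂ ⁅x, y⁆ = 0
  sub_mem_derived : ∀ x, x - (incl₁ (proj₁ x) + incl₂ (proj₂ x)) ∈
    ⁅(⊤ : LieIdeal K L), (⊤ : LieIdeal K L)⁆

namespace DerivedSplitting

attribute [local instance 100] LieRing.ofAssociativeRing

variable (S : DerivedSplitting K L V₁ V₂)

/-- An element of the abelian Lie algebra `Hom(V₂, V₁)`, as a linear map. -/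
def homEquiv : AbelianHom K V₁ V₂ ≃ₗ[K] (V₂ →ₗ[K] V₁) := LinearEquiv.refl K (V₂ →ₗ[K] V₁)

/-- The derivation of `L` given by an element of `Hom(V₁ ∔ V₂, V₁)`: the linear map on `V₁ ∔ V₂`
is extended by zero to the derived algebra, and `V₁` is identified with the center. -/
def derivationOf (a : HomLie K V₁ V₂) : LieDerivation K L L where
  toLinearMap := S.incl₁ ∘ₗ (LinearMap.comp a.right S.proj₁ +
    LinearMap.comp (homEquiv a.left) S.proj₂)
  leibniz' x y := by
    have h (x : L) (v : V₁) : ⁅x, S.incl₁ v⁆ = 0 :=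
      (LieModule.mem_maxTrivSubmodule K L L _).1 (S.incl₁_mem_center v) x
    simp only [LinearMap.comp_apply, LinearMap.add_apply, S.proj₁_lie, S.proj₂_lie, map_zero, h,
      add_zero, sub_zero]

lemma derivationOf_apply (a : HomLie K V₁ V₂) (x : L) :
    S.derivationOf a x =
      S.incl₁ (a.right (S.proj₁ x) + homEquiv a.left (S.proj₂ x)) := rfl

/-- The composite of two maps into the center only sees the component of the first one in `V₁`, so
that the commutator is the bracket of the semidirect sum. -/
lemma derivationOf_lie (a c : HomLie K V₁ V₂) :
    S.derivationOf ⁅a, c⁆ = ⁅S.derivationOf a, S.derivationOf c⁆ := by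
  ext x
  rw [LieDerivation.commutator_apply]
  simp only [derivationOf_apply, S.proj₁_incl₁, S.proj₂_incl₁, map_zero, add_zero]
  have hr : ⁅a, c⁆.right (S.proj₁ x) =
      a.right (c.right (S.proj₁ x)) - c.right (a.right (S.proj₁ x)) := rfl
  have hl : homEquiv ⁅a, c⁆.left (S.proj₂ x) =
      0 + a.right (homEquiv c.left (S.proj₂ x)) - c.right (homEquiv a.left (S.proj₂ x)) := rfl
  rw [hr, hl, ← map_sub]
  congr 1
  rw [map_add, map_add]
  abel

/-- The action of `Hom(V₁ ∔ V₂, V₁)` on `L` by derivations with central values. -/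
def toDerivation : HomLie K V₁ V₂ →ₗ⁅K⁆ LieDerivation K L L where
  toFun := S.derivationOf
  map_add' a c := by
    ext x
    rw [LieDerivation.add_apply]
    simp only [derivationOf_apply]
    rw [← map_add]
    congr 1
    change (a.right + c.right) _ + homEquiv (a.left + c.left) _ = _
    rw [map_add, LinearMap.add_apply, LinearMap.add_apply]
    abel
  map_smul' t a := by
    ext x
    rw [RingHom.id_apply, LieDerivation.smul_apply]
    simp only [derivationOf_apply]
    rw [← map_smul]
    congr 1
    change (t • a.right) _ + homEquiv (t • a.left) _ = _
    rw [map_smul, LinearMap.smul_apply, LinearMap.smul_apply, smul_add]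
  map_lie' {a c} := S.derivationOf_lie a c

lemma toDerivation_apply (a : HomLie K V₁ V₂) (x : L) :
    S.toDerivation a x =
      S.incl₁ (a.right (S.proj₁ x) + homEquiv a.left (S.proj₂ x)) := rfl

lemma toDerivation_mem (a : HomLie K V₁ V₂) : S.toDerivation a ∈ centralDerivations K L :=
  fun _ ↦ S.incl₁_mem_center _

lemma toDerivation_injective : Function.Injective S.toDerivation := by
  rw [injective_iff_map_eq_zero]
  intro a ha
  have h := fun x ↦ congrArg S.proj₁ (LieDerivation.congr_fun ha x)
  simp only [toDerivation_apply, S.proj₁_incl₁, LieDerivation.zero_apply, map_zero] at h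
  refine SemiDirectSum.ext ?_ ?_
  · refine homEquiv.injective (LinearMap.ext fun v ↦ ?_)
    have := h (S.incl₂ v)
    rwa [S.proj₁_incl₂, S.proj₂_incl₂, map_zero, zero_add] at this
  · refine LinearMap.ext fun v ↦ ?_
    have := h (S.incl₁ v)
    rwa [S.proj₁_incl₁, S.proj₂_incl₁, map_zero, add_zero] at this

lemma exists_toDerivation_eq {D : LieDerivation K L L} (hD : D ∈ centralDerivations K L) :
    ∃ a, S.toDerivation a = D := by
  refine ⟨⟨(S.proj₁ ∘ₗ (D : L →ₗ[K] L) ∘ₗ S.incl₂ : V₂ →ₗ[K] V₁),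
    (S.proj₁ ∘ₗ (D : L →ₗ[K] L) ∘ₗ S.incl₁ : V₁ →ₗ[K] V₁)⟩, ?_⟩
  ext x
  have h1 := apply_eq_zero_of_mem_derived hD (S.sub_mem_derived x)
  rw [map_sub, sub_eq_zero] at h1
  rw [h1, toDerivation_apply]
  change S.incl₁ (S.proj₁ (D (S.incl₁ (S.proj₁ x))) + S.proj₁ (D (S.incl₂ (S.proj₂ x)))) = _
  rw [← map_add, ← map_add, S.incl₁_proj₁ _ (hD _)]

/-- If every derivation of `L` is, up to a derivation with central values, given by a unique element
of `M`, then the derivations of `L` are the direct sum of `Hom(V₁ ∔ V₂, V₁)` and `M`. -/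
theorem nonempty_equiv (S : DerivedSplitting K L V₁ V₂) (j : M →ₗ⁅K⁆ L)
    (hj : ∀ u, LieDerivation.ad K L (j u) ∈ centralDerivations K L → u = 0)
    (hD : ∀ D, ∃ u, D - LieDerivation.ad K L (j u) ∈ centralDerivations K L) :
    Nonempty (LieDerivation K L L ≃ₗ⁅K⁆ HomLie K V₁ V₂ × M) := by
  have hcomm : ∀ a u, ⁅S.toDerivation a, LieDerivation.ad K L (j u)⁆ = 0 := by
    intro a u
    rw [LieDerivation.lie_der_ad_eq_ad_der, ← LieHom.mem_ker, LieDerivation.ad_ker_eq_center]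
    exact S.toDerivation_mem a _
  let Φ : HomLie K V₁ V₂ × M →ₗ⁅K⁆ LieDerivation K L L :=
    { toFun := fun a ↦ S.toDerivation a.1 + LieDerivation.ad K L (j a.2)
      map_add' := fun a c ↦ by
        rw [Prod.fst_add, Prod.snd_add, map_add, map_add, map_add]
        abel
      map_smul' := fun t a ↦ by
        rw [Prod.smul_fst, Prod.smul_snd, map_smul, map_smul, map_smul, smul_add, RingHom.id_apply]
      map_lie' := fun {a c} ↦ by
        have h := hcomm c.1 a.2
        rw [← lie_skew, neg_eq_zero] at h
        change S.toDerivation ⁅a.1, c.1⁆ + LieDerivation.ad K L (j ⁅a.2, c.2⁆) = _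
        rw [add_lie, lie_add, lie_add, hcomm, h, add_zero, zero_add, LieHom.map_lie, LieHom.map_lie,
          LieHom.map_lie] }
  refine ⟨(LieEquiv.ofBijective Φ ⟨?_, ?_⟩).symm⟩
  · rw [injective_iff_map_eq_zero]
    intro a ha
    have ha' : S.toDerivation a.1 + LieDerivation.ad K L (j a.2) = 0 := ha
    have h2 : a.2 = 0 := by
      refine hj _ ?_
      rw [eq_neg_of_add_eq_zero_right ha']
      exact neg_mem (S.toDerivation_mem _)
    rw [h2, map_zero, map_zero, add_zero] at ha'
    have h1 : a.1 = 0 := S.toDerivation_injective (by rw [ha', map_zero])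
    exact Prod.ext h1 h2
  · intro D
    obtain ⟨u, hu⟩ := hD D
    obtain ⟨a, ha⟩ := S.exists_toDerivation_eq hu
    refine ⟨(a, u), ?_⟩
    change S.toDerivation a + LieDerivation.ad K L (j u) = D
    rw [ha, sub_add_cancel]

end DerivedSplitting

end Equivalence

/-- A projection of a space onto a subspace `A` that kills a subspace `B` disjoint from `A`. -/
lemma exists_projection_of_disjoint {K V : Type*} [Field K] [AddCommGroup V] [Module K V]
    {A B : Submodule K V}
    (h : Disjoint A B) : ∃ P : V →ₗ[K] A, (∀ a : A, P a = a) ∧ ∀ x ∈ B, P x = 0 := by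
  obtain ⟨C, hBC, hC⟩ := h.symm.exists_isCompl
  refine ⟨Submodule.projectionOnto _ _ hC.symm, Submodule.projectionOnto_apply_left hC.symm,
    fun x hx ↦ ?_⟩
  have : x ∈ LinearMap.ker (Submodule.projectionOnto _ _ hC.symm) := by
    rw [Submodule.ker_projectionOnto]
    exact hBC hx
  exact this

section Splitting

variable {K : Type*} {g : Type*} [Field K] [IsAlgClosed K] [CharZero K] [LieRing g] [LieAlgebra K g]
  [FiniteDimensional K g] [HasCentralRadical K g] {q : LieSubalgebra K g}
  {H : LieSubalgebra K (semisimplePart K g)} [H.IsCartanSubalgebra] {b : (rootSystem H).Base}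
  {Δ' : Set H.root}

/-- The splitting of a parabolic subalgebra `q` given by `q = 𝔤_Z ∔ 𝔠 ∔ [q, q]`. -/
lemma IsParabolic.nonempty_derivedSplitting (hq : IsParabolic q) (hΔ' : Δ' ⊆ b.support)
    (hp : (semisimpleInter q).toSubmodule = standardParabolic b Δ') :
    Nonempty (DerivedSplitting K q (center K g) (corootSpan b Δ')) := by
  obtain ⟨h12, h13, -⟩ := iSupIndep_fin_three.1 (hq.iSupIndep hΔ' hp)
  have hZ : Disjoint (center K g).toSubmodule (corootSpan b Δ' ⊔ derivedSubspace q) := h12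
  have hC : Disjoint (corootSpan b Δ') (derivedSubspace q ⊔ (center K g).toSubmodule) := h13
  obtain ⟨P, hP, hP'⟩ := exists_projection_of_disjoint hZ
  obtain ⟨Q, hQ, hQ'⟩ := exists_projection_of_disjoint hC
  have hlie : ∀ x y : q, ((⁅x, y⁆ : q) : g) ∈ derivedSubspace q := fun x y ↦
    (mem_derivedSubspace_iff _).2
      (LieSubmodule.lie_mem_lie (LieSubmodule.mem_top x) (LieSubmodule.mem_top y))
  refine ⟨{
    incl₁ := Submodule.inclusion (p' := q.toSubmodule) hq.center_le
    incl₂ := Submodule.inclusion (p' := q.toSubmodule) (corootSpan_le hp)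
    proj₁ := P ∘ₗ q.toSubmodule.subtype
    proj₂ := Q ∘ₗ q.toSubmodule.subtype
    incl₁_mem_center := fun v ↦ (hq.mem_center_iff _).2 v.2
    incl₁_proj₁ := fun x hx ↦
      Subtype.ext (congrArg (Subtype.val : center K g → g) (hP ⟨x, (hq.mem_center_iff x).1 hx⟩))
    proj₁_incl₁ := hP
    proj₂_incl₁ := fun v ↦ hQ' _ (Submodule.mem_sup_right v.2)
    proj₁_incl₂ := fun v ↦ hP' _ (Submodule.mem_sup_left v.2)
    proj₂_incl₂ := hQ
    proj₁_lie := fun x y ↦ hP' _ (Submodule.mem_sup_right (hlie x y))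
    proj₂_lie := fun x y ↦ hQ' _ (Submodule.mem_sup_left (hlie x y))
    sub_mem_derived := fun x ↦ ?_ }⟩
  rw [← mem_derivedSubspace_iff]
  have hx : (x : g) ∈ (center K g).toSubmodule ⊔ corootSpan b Δ' ⊔ derivedSubspace q := by
    rw [hq.sup_eq hp]
    exact x.2
  obtain ⟨y, hy, w, hw, hx⟩ := Submodule.mem_sup.1 hx
  obtain ⟨z, hz, c, hc, rfl⟩ := Submodule.mem_sup.1 hy
  have hPx : P x = ⟨z, hz⟩ := by
    rw [← hx, map_add, map_add, hP ⟨z, hz⟩, hP' c (Submodule.mem_sup_left hc),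
      hP' w (Submodule.mem_sup_right hw), add_zero, add_zero]
  have hQx : Q x = ⟨c, hc⟩ := by
    rw [← hx, map_add, map_add, hQ ⟨c, hc⟩, hQ' z (Submodule.mem_sup_right hz),
      hQ' w (Submodule.mem_sup_left hw), zero_add, add_zero]
  change (x : g) - ((P x : g) + (Q x : g)) ∈ _
  rw [hPx, hQx, ← hx, add_sub_cancel_left]
  exact hw

/-- An inner derivation given by an element of `q ∩ g_S` has central values only if it is zero. -/
lemma IsParabolic.eq_zero_of_ad_mem (hq : IsParabolic q) (u : semisimpleInter q)
    (hu : LieDerivation.ad K q (semisimpleInterIncl q u) ∈ centralDerivations K q) : u = 0 := by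
  refine hq.eq_zero_of_mem_center ?_
  rw [← LieDerivation.ad_ker_eq_center, LieHom.mem_ker, ← LieSubmodule.mem_bot (R := K)
    (L := LieDerivation K q q), ← hq.isCompl_centralDerivations.inf_eq_bot]
  exact ⟨hu, LieDerivation.mem_ad_idealRange_iff.2 ⟨_, rfl⟩⟩

end Splitting

end LieParabolic

theorem proposition3p1 {K : Type*} {g : Type*} [Field K] [IsAlgClosed K] [CharZero K]
    [LieRing g] [LieAlgebra K g] [FiniteDimensional K g] [HasCentralRadical K g]
    (q : LieSubalgebra K g) (hq : IsParabolic q) :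
    (∃ I : LieIdeal K (LieDerivation K q q),
      (∀ f : q →ₗ[K] q, f ∈ centralMaps K q ↔ ∃ D ∈ I, (D : q →ₗ[K] q) = f) ∧
      IsCompl I (LieDerivation.ad K q).idealRange) ∧
    ∀ (H : LieSubalgebra K (semisimplePart K g)) [H.IsCartanSubalgebra]
      (b : (rootSystem H).Base) (Δ' : Set H.root), Δ' ⊆ b.support →
      (semisimpleInter q).toSubmodule = standardParabolic b Δ' →
      (iSupIndep ![(center K g).toSubmodule, corootSpan b Δ', derivedSubspace q] ∧
        (center K g).toSubmodule ⊔ corootSpan b Δ' ⊔ derivedSubspace q = q.toSubmodule) ∧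
      (∀ f : q →ₗ[K] q, f ∈ centralMaps K q ↔
        (∀ x : q, (x : g) ∈ (center K g).toSubmodule ⊔ corootSpan b Δ' → (f x : g) ∈ center K g) ∧
        (∀ x : q, (x : g) ∈ derivedSubspace q → f x = 0)) ∧
      Nonempty (LieDerivation K q q ≃ₗ⁅K⁆
        HomLie K (center K g) (corootSpan b Δ') × semisimpleInter q) := by
  refine ⟨⟨centralDerivations K q, fun _ ↦ mem_centralMaps_iff_exists,
    hq.isCompl_centralDerivations⟩, ?_⟩
  intro H _ b Δ' hΔ' hp
  obtain ⟨S⟩ := hq.nonempty_derivedSplitting hΔ' hp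
  exact ⟨⟨hq.iSupIndep hΔ' hp, hq.sup_eq hp⟩, fun f ↦ hq.mem_centralMaps_iff hp f,
    S.nonempty_equiv (semisimpleInterIncl q) hq.eq_zero_of_ad_mem hq.exists_sub_ad_mem⟩
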